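/- Consider a tracker $p$ and a target $q$ that move in the free space $F$ of the Euclidean plane with polygonal obstacles. Here the obstacle set is a union of convex polygons with nonempty interior, locally finite but possibly infinite, and $F$ is the complement of the interior of this union. Both agents move in $F$ with speed at most $1$ over all times $t\ge 0$. Let $d_F(x,y)$ be the geodesic distance, that is, the infimum of the lengths of the paths in $F$ from $x$ to $y$, and let $D(t)=d_F(p(t),q(t))$. Under the path-proportionate error model with localization precision $\lambda\ge 1$, the tracker observes only a reported location $q'(t)$ of the target, which may be chosen adversarially subject to $$d_F(q(t),q'(t))\le \frac{1}{\lambda}\,D(t)\qquad\text{for all } t\ge 0 .$$ A (deterministic) tracker strategy with initial position $p_0$ assigns to each signal of reported locations a motion of the tracker from $p_0$, whose position at time $t$ depends only on the locations reported up to time $t$. A phase strategy of the target with initial position $q_0$ consists of times $0=t_0<t_1<t_2<\cdots\to\infty$ and, for each sequence $b\in\{0,1\}^{\mathbb N}$ of choices, a motion $q_b$ of the target from $q_0$ and a signal $q'_b$ of reported locations. The motion $q_b$ up to time $t_{i+1}$ depends only on $b_0,\dots,b_i$, while the locations $q'_b(t)$ reported at times $t<t_{i+1}$ depend only on $b_0,\dots,b_{i-1}$.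 Thus the two alternatives of the target in phase $i$, the time interval from $t_i$ to $t_{i+1}$, cannot be told apart by the tracker during that phase. **Theorem.** There is an absolute constant $c>0$ such that for every $\lambda\ge 1$ and every $d_0>0$ there are a polygonal environment $F$, initial positions $p_0,q_0$ with $d_F(p_0,q_0)=d_0$, and a phase strategy of the target with the following property. For every tracker strategy there is a sequence $b$ of choices of the target for which the path-proportionate error bound holds at all times $t\ge 0$ and, at the end of every phase, $$D(t_n)\ \ge\ D(0)+c\,\frac{t_n}{\lambda}\qquad\text{for all } n\ge 0 .$$ Moreover, each phase lasts at most $t_{n+1}-t_n\le(1+\frac1\lambda)\,D(t_n)$. -/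

import Mathlib

open scoped NNReal ENNReal

namespace Tracking

/-- The Euclidean plane. -/
abbrev Plane : Type := EuclideanSpace ℝ (Fin 2)

/-- A (nondegenerate, compact) convex polygon: the convex hull of finitely many points,
with nonempty interior. -/
def IsConvexPolygon (P : Set Plane) : Prop :=
  (∃ V : Finset Plane, P = convexHull ℝ (V : Set Plane)) ∧ (interior P).Nonempty

/-- `F` is the free space of the plane with polygonal obstacles.
The obstacles are presented through a decomposition into convex polygons, of which only finitely
many meet a neighbourhood of any given point; pieces that share an edge or overlap form one, in
general nonconvex, obstacle. The agents may touch an obstacle but may not enter its interior;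
since the interior is taken of the union, no agent can move along an edge shared by two
pieces. -/
def IsPolygonalEnvironment (F : Set Plane) : Prop :=
  ∃ (ι : Type) (P : ι → Set Plane),
    (∀ i, IsConvexPolygon (P i)) ∧ LocallyFinite P ∧ F = (interior (⋃ i, P i))ᶜ

/-- `γ`, restricted to `[0, 1]`, is a continuous path in `F` from `x` to `y`. -/
def IsPathIn (F : Set Plane) (x y : Plane) (γ : ℝ → Plane) : Prop :=
  ContinuousOn γ (Set.Icc 0 1) ∧ Set.MapsTo γ (Set.Icc 0 1) F ∧ γ 0 = x ∧ γ 1 = y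

/-- The shortest path (geodesic) distance in `F`: the infimum of the lengths of the paths in `F`
from `x` to `y` (it is `∞` when there is no rectifiable path). -/
noncomputable def geodesicDist (F : Set Plane) (x y : Plane) : ℝ≥0∞ :=
  ⨅ (γ : ℝ → Plane) (_ : IsPathIn F x y γ), eVariationOn γ (Set.Icc 0 1)

/-- A motion of an agent: a trajectory in `F`, over all times `t ≥ 0`, of speed at most one. -/
def IsMotion (F : Set Plane) (x : ℝ≥0 → Plane) : Prop :=
  (∀ t, x t ∈ F) ∧ ∀ s t, dist (x s) (x t) ≤ dist s t

/-- A deterministic strategy of the tracker in `F` with initial position `p₀`. It turns the signal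
of reported locations into a motion of the tracker, and the tracker's position at time `t` depends
only on the locations reported up to time `t`. -/
structure TrackerStrategy (F : Set Plane) (p₀ : Plane) where
  /-- the motion of the tracker in response to a signal -/
  path : (ℝ≥0 → Plane) → ℝ≥0 → Plane
  start : ∀ a, path a 0 = p₀
  motion : ∀ a, IsMotion F (path a)
  causal : ∀ (a a' : ℝ≥0 → Plane) (t : ℝ≥0), (∀ s ≤ t, a s = a' s) → path a t = path a' t

/-- A strategy of the target in `F`, with initial position `q₀`, that proceeds in phases.
Phase `i` lasts from `time i` to `time (i + 1)`, and in it the target follows one of two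
alternative paths, according to the `i`-th entry of the sequence `b` of its choices. The locations
reported during a phase are the same for both alternatives of that phase. -/
structure PhaseStrategy (F : Set Plane) (q₀ : Plane) where
  /-- the times at which the phases begin and end -/
  time : ℕ → ℝ≥0
  time_zero : time 0 = 0
  time_strictMono : StrictMono time
  time_tendsto : Filter.Tendsto time Filter.atTop Filter.atTop
  /-- the true location of the target -/
  target : (ℕ → Bool) → ℝ≥0 → Plane
  /-- the reported location of the target -/
  report : (ℕ → Bool) → ℝ≥0 → Plane
  start : ∀ b, target b 0 = q₀
  motion : ∀ b, IsMotion F (target b)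
  target_causal : ∀ (b b' : ℕ → Bool) (i : ℕ), (∀ j ≤ i, b j = b' j) →
    ∀ t ≤ time (i + 1), target b t = target b' t
  report_causal : ∀ (b b' : ℕ → Bool) (i : ℕ), (∀ j < i, b j = b' j) →
    ∀ t < time (i + 1), report b t = report b' t

/-- The path proportionate error model with localization precision `lam`: at all times, the
geodesic distance from the true location `q t` to the reported location `a t` is at most
`1 / lam` times the geodesic distance from the tracker `p t` to the target `q t`. -/
def PathProportionateError (F : Set Plane) (lam : ℝ) (p q a : ℝ≥0 → Plane) : Prop :=
  ∀ t, geodesicDist F (q t) (a t) ≤ geodesicDist F (p t) (q t) / ENNReal.ofReal lam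

end Tracking

/-!
The environment is a tree of corridors. All obstacles are axis-parallel rectangles, and the
corridors are so narrow in the direction of the first coordinate that only the movements in the
direction of the second coordinate, the height, matter. Level `n` of the environment occupies the
heights between `base n` and `base (n + 1)`. In the first coordinate it is divided into cells, of
which each contains two vertical corridors, its rails. (For simplicity the level is periodic, with
cells also where the target never gets.) Both rails start from the fork at the bottom of the
cell, and each of them is, at the next level, a cell with two rails of its own. The rails of a cell
are connected in each of its many storeys by a passage that leads up and then down again, so that a
change from one rail to the other costs at least `2 * v n`, where `v n` is the unit of length of the
level. At the top of the level the rails are separated forever.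

The target climbs one level per phase, and its choice in phase `n` is the rail that it takes. The
report shows the position on the left rail in any case, which is within the error bound because the
passages are close to each other (`Layout.geodesicDist_xpos_le`). The length of the phase is
such that a tracker that stays behind the target can get past the fork before the phase ends, and has to guess. If
the guess is wrong, it loses `2 * v n`; if it waits at the fork, it loses even more. The number of
storeys is chosen such that `v n` is of the order of the distance divided by `lam`.

Distances are bounded from below by potentials: a function that is 1-Lipschitz near each point of
the free space is 1-Lipschitz for the geodesic distance (`edist_le_geodesicDist`). The potential
`Layout.pot b n` is the height inside the tube of the first `n` choices of `b`, and a lower bound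
for the height minus the length of the detour elsewhere. It is 1-Lipschitz
(`Layout.eventually_abs_pot_sub_le`) since its values on the two sides of each door agree. The
possible choices in a phase give two extensions of the potential, and at each point that is
well above the fork one of them is smaller by `2 * v n` (`Layout.exists_pot_succ_le`). The target
takes this choice for the position of the tracker at the end of the phase, which does not depend on
the choice (`PhaseStrategy.path_congr`). Thus the difference between the potentials of the target
and the tracker grows as required (`exists_choices_pot_le`).
-/

namespace Tracking

open Set Filter Topology

/-! ### Paths and the geodesic distance -/

theorem geodesicDist_le_of_path {F : Set Plane} {γ : ℝ → Plane} {a b : ℝ} (hab : a ≤ b)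
    (hc : ContinuousOn γ (Icc a b)) (hm : MapsTo γ (Icc a b) F) :
    geodesicDist F (γ a) (γ b) ≤ eVariationOn γ (Icc a b) := by
  set φ : ℝ → ℝ := fun s => a + s * (b - a) with hφ
  have hba : 0 ≤ b - a := sub_nonneg.2 hab
  have hmap : MapsTo φ (Icc 0 1) (Icc a b) := by
    intro s hs
    refine ⟨by simp only [hφ]; nlinarith [hs.1], by simp only [hφ]; nlinarith [hs.2]⟩
  have hmono : MonotoneOn φ (Icc 0 1) := by
    intro s _ t _ hst
    simp only [hφ]
    nlinarith
  have hp : IsPathIn F (γ a) (γ b) (γ ∘ φ) :=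
    ⟨hc.comp (by fun_prop) hmap, hm.comp hmap, by simp [hφ], by simp [hφ]⟩
  calc geodesicDist F (γ a) (γ b) ≤ eVariationOn (γ ∘ φ) (Icc 0 1) :=
        iInf₂_le (γ ∘ φ) hp
    _ ≤ _ := eVariationOn.comp_le_of_monotoneOn γ φ hmono hmap

theorem geodesicDist_self {F : Set Plane} {x : Plane} (hx : x ∈ F) : geodesicDist F x x = 0 := by
  have h := geodesicDist_le_of_path (F := F) (γ := fun _ => x) (le_refl (0 : ℝ))
    continuousOn_const (fun _ _ => hx)
  rw [eVariationOn.subsingleton _ (by simp)] at h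
  exact le_antisymm h bot_le

theorem geodesicDist_triangle (F : Set Plane) (x y z : Plane) :
    geodesicDist F x z ≤ geodesicDist F x y + geodesicDist F y z := by
  have key : ∀ γ₁, IsPathIn F x y γ₁ → ∀ γ₂, IsPathIn F y z γ₂ →
      geodesicDist F x z ≤ eVariationOn γ₁ (Icc 0 1) + eVariationOn γ₂ (Icc 0 1) := by
    rintro γ₁ ⟨hc₁, hm₁, hx, hy⟩ γ₂ ⟨hc₂, hm₂, hy', hz⟩
    set γ : ℝ → Plane := fun s => if s ≤ 1 then γ₁ s else γ₂ (s - 1) with hγ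
    have e₁ : EqOn γ γ₁ (Icc 0 1) := fun s hs => if_pos hs.2
    have e₂ : EqOn γ (γ₂ ∘ fun s => s - 1) (Icc 1 2) := by
      intro s hs
      rcases hs.1.eq_or_lt with rfl | h
      · simp [hγ, hy, hy']
      · simp [hγ, not_le.2 h]
    have hmap : MapsTo (fun s : ℝ => s - 1) (Icc 1 2) (Icc 0 1) := fun s hs =>
      ⟨by linarith [hs.1], by linarith [hs.2]⟩
    have hu : Icc (0 : ℝ) 2 = Icc 0 1 ∪ Icc 1 2 :=
      (Icc_union_Icc_eq_Icc zero_le_one one_le_two).symm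
    have hc : ContinuousOn γ (Icc 0 2) := by
      rw [hu]
      exact (hc₁.congr e₁).union_of_isClosed
        ((hc₂.comp (by fun_prop) hmap).congr e₂) isClosed_Icc isClosed_Icc
    have hm : MapsTo γ (Icc 0 2) F := by
      rw [hu]
      exact (hm₁.congr e₁.symm).union ((hm₂.comp hmap).congr e₂.symm)
    have h := geodesicDist_le_of_path zero_le_two hc hm
    have h0 : γ 0 = x := by simp [hγ, hx]
    have h2 : γ 2 = z := by simp [hγ, ← hz]; norm_num
    rw [h0, h2] at h
    refine h.trans ?_
    have h3 := eVariationOn.Icc_add_Icc γ zero_le_one one_le_two (mem_univ (1 : ℝ))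
    simp only [univ_inter] at h3
    rw [← h3, eVariationOn.congr e₁, eVariationOn.congr e₂]
    gcongr
    exact eVariationOn.comp_le_of_monotoneOn _ _ (fun s _ t _ h => by simpa using h) hmap
  have key₂ : ∀ γ₂, IsPathIn F y z γ₂ →
      geodesicDist F x z ≤ geodesicDist F x y + eVariationOn γ₂ (Icc 0 1) := by
    intro γ₂ h₂
    conv_rhs => unfold geodesicDist
    simp_rw [ENNReal.iInf_add]
    exact le_iInf₂ fun γ₁ h₁ => key γ₁ h₁ γ₂ h₂
  conv_rhs => rw [geodesicDist.eq_def F y z]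
  simp_rw [ENNReal.add_iInf]
  exact le_iInf₂ key₂

/-- A function that changes, near each point of the free space, by no more than the distance from
that point gives a lower bound for the geodesic distance. -/
theorem edist_le_geodesicDist {F : Set Plane} {f : Plane → ℝ}
    (hf : ∀ p ∈ F, ∀ᶠ z in 𝓝[F] p, edist (f z) (f p) ≤ edist z p) (x y : Plane) :
    edist (f x) (f y) ≤ geodesicDist F x y := by
  refine le_iInf fun γ => le_iInf fun hγ => ?_
  obtain ⟨hc, hm, h0, h1⟩ := hγ
  have key : ∀ s ∈ Icc (0 : ℝ) 1, ∃ ε > 0, ∀ s' ∈ Icc (0 : ℝ) 1, |s' - s| < ε →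
      edist (f (γ s')) (f (γ s)) ≤ edist (γ s') (γ s) := by
    intro s hs
    have h := ((hc s hs).tendsto_nhdsWithin hm).eventually (hf _ (hm hs))
    rw [eventually_nhdsWithin_iff, Metric.eventually_nhds_iff] at h
    obtain ⟨ε, hε, h⟩ := h
    exact ⟨ε, hε, fun s' hs' hd => h hd hs'⟩
  let good : ℝ → Prop := fun s => edist (f (γ 0)) (f (γ s)) ≤ eVariationOn γ (Icc 0 s)
  have ext : ∀ s u, 0 ≤ s → s ≤ u → good s →
      edist (f (γ u)) (f (γ s)) ≤ edist (γ u) (γ s) → good u := by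
    intro s u hs hsu hg h
    calc edist (f (γ 0)) (f (γ u)) ≤ edist (f (γ 0)) (f (γ s)) + edist (f (γ s)) (f (γ u)) :=
          edist_triangle _ _ _
      _ ≤ eVariationOn γ (Icc 0 s) + eVariationOn γ (Icc s u) := by
          refine add_le_add hg ?_
          rw [edist_comm]
          exact h.trans (eVariationOn.edist_le _ ⟨hsu, le_rfl⟩ ⟨le_rfl, hsu⟩)
      _ = eVariationOn γ (Icc 0 u) := by
          simpa using eVariationOn.Icc_add_Icc γ hs hsu (mem_univ s)
  -- all parameters up to `s` are required to be good, which makes the set closed from the right too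
  let S : Set ℝ := {s | ∀ u ∈ Icc (0 : ℝ) 1, u ≤ s → good u}
  have hS : Icc (0 : ℝ) 1 ⊆ S := by
    refine IsClosed.Icc_subset_of_forall_exists_gt ?_ ?_ ?_
    · refine isClosed_of_closure_subset fun s hs => ?_
      have hs01 : s ∈ Icc (0 : ℝ) 1 := closure_minimal inter_subset_right isClosed_Icc hs
      rw [Metric.mem_closure_iff] at hs
      refine ⟨fun u hu hus => ?_, hs01⟩
      rcases hus.lt_or_eq with hlt | rfl
      · obtain ⟨s', hs', hd⟩ := hs (s - u) (by linarith)
        rw [Real.dist_eq] at hd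
        exact hs'.1 u hu (by linarith [(abs_lt.1 hd).2])
      · obtain ⟨ε, hε, h⟩ := key u hu
        obtain ⟨s', hs', hd⟩ := hs ε hε
        rcases le_total u s' with hle | hle
        · exact hs'.1 u hu hle
        · rw [dist_comm, Real.dist_eq] at hd
          have := h s' hs'.2 hd
          refine ext s' u hs'.2.1 hle (hs'.1 s' hs'.2 le_rfl) ?_
          rwa [edist_comm, edist_comm (γ u)]
    · intro u hu hu0
      have : u = 0 := le_antisymm hu0 hu.1
      simp [good, this]
    · rintro s ⟨hsS, hs⟩ y hy
      obtain ⟨ε, hε, h⟩ := key s ⟨hs.1, hs.2.le⟩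
      refine ⟨min y (s + ε / 2), fun u hu hus => ?_, ?_, min_le_left _ _⟩
      · rcases le_total u s with hle | hle
        · exact hsS u hu hle
        · have h2 := hus.trans (min_le_right _ _)
          exact ext s u hs.1 hle (hsS s ⟨hs.1, hs.2.le⟩ le_rfl)
            (h u hu (by rw [abs_lt]; constructor <;> linarith))
      · exact lt_min hy (by linarith)
  have := hS ⟨zero_le_one, le_rfl⟩ 1 ⟨zero_le_one, le_rfl⟩ le_rfl
  simpa only [good, h0, h1] using this

theorem IsMotion.geodesicDist_le {F : Set Plane} {p : ℝ≥0 → Plane} (hp : IsMotion F p) {s t : ℝ≥0}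
    (hst : s ≤ t) : geodesicDist F (p s) (p t) ≤ ENNReal.ofReal ((t : ℝ) - s) := by
  have hL : LipschitzWith 1 (fun u : ℝ => p u.toNNReal) := by
    refine LipschitzWith.of_dist_le_mul fun u v => ?_
    refine (hp.2 _ _).trans ?_
    have := Real.lipschitzWith_toNNReal.dist_le_mul u v
    simpa using this
  have h := geodesicDist_le_of_path (F := F) (γ := fun u : ℝ => p u.toNNReal)
    (NNReal.coe_le_coe.2 hst) hL.continuous.continuousOn (fun _ _ => hp.1 _)
  simp only [Real.toNNReal_coe] at h
  refine h.trans ?_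
  have h2 := (hL.lipschitzOnWith (s := univ)).comp_eVariationOn_le
    (g := id) (s := Icc (s : ℝ) t) (mapsTo_univ _ _)
  simp only [Function.comp_id, eVariationOn_id_Icc] at h2
  simpa using h2

theorem geodesicDist_le_of_segment {F : Set Plane} {x y : Plane} (h : segment ℝ x y ⊆ F) :
    geodesicDist F x y ≤ edist x y := by
  have hL : LipschitzWith (nndist x y) (fun u : ℝ => AffineMap.lineMap x y u) :=
    lipschitzWith_lineMap x y
  have h1 := geodesicDist_le_of_path (F := F) (γ := fun u : ℝ => AffineMap.lineMap x y u)
    zero_le_one hL.continuous.continuousOn (fun u hu => h (by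
      rw [segment_eq_image_lineMap]; exact ⟨u, hu, rfl⟩))
  simp only [AffineMap.lineMap_apply_zero, AffineMap.lineMap_apply_one] at h1
  refine h1.trans ?_
  have h2 := (hL.lipschitzOnWith (s := univ)).comp_eVariationOn_le
    (g := id) (s := Icc (0 : ℝ) 1) (mapsTo_univ _ _)
  simp only [Function.comp_id, eVariationOn_id_Icc] at h2
  rw [edist_nndist]
  exact h2.trans (by simp)

/-! ### Rectangles -/

/-- The closed axis-parallel rectangle `[x₀, x₁] × [y₀, y₁]`, as the convex hull of its corners. -/
def rect (x₀ x₁ y₀ y₁ : ℝ) : Set Plane :=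
  convexHull ℝ {!₂[x₀, y₀], !₂[x₁, y₀], !₂[x₀, y₁], !₂[x₁, y₁]}

theorem mem_rect_iff {x₀ x₁ y₀ y₁ : ℝ} (hx : x₀ < x₁) (hy : y₀ < y₁) (z : Plane) :
    z ∈ rect x₀ x₁ y₀ y₁ ↔ (x₀ ≤ z 0 ∧ z 0 ≤ x₁) ∧ y₀ ≤ z 1 ∧ z 1 ≤ y₁ := by
  constructor
  · intro hz
    have hconv : Convex ℝ {z : Plane | (x₀ ≤ z 0 ∧ z 0 ≤ x₁) ∧ y₀ ≤ z 1 ∧ z 1 ≤ y₁} := by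
      intro a ha b hb s t hs ht hst
      obtain ⟨⟨a1, a2⟩, a3, a4⟩ := ha
      obtain ⟨⟨b1, b2⟩, b3, b4⟩ := hb
      obtain rfl : t = 1 - s := by linarith
      simp only [mem_ofPred_eq, PiLp.add_apply, PiLp.smul_apply, smul_eq_mul]
      refine ⟨⟨?_, ?_⟩, ?_, ?_⟩ <;> nlinarith
    refine convexHull_min ?_ hconv hz
    intro w hw
    simp only [mem_insert_iff, mem_singleton_iff] at hw
    rcases hw with rfl | rfl | rfl | rfl <;> simp [hx.le, hy.le]
  · rintro ⟨⟨h1, h2⟩, h3, h4⟩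
    have hx' : 0 < x₁ - x₀ := sub_pos.2 hx
    have hy' : 0 < y₁ - y₀ := sub_pos.2 hy
    set s := (z 0 - x₀) / (x₁ - x₀) with hs
    set t := (z 1 - y₀) / (y₁ - y₀) with ht
    have hs0 : 0 ≤ s := div_nonneg (by linarith) hx'.le
    have ht0 : 0 ≤ t := div_nonneg (by linarith) hy'.le
    have hs1 : 0 ≤ 1 - s := by rw [sub_nonneg, hs, div_le_one hx']; linarith
    have ht1 : 0 ≤ 1 - t := by rw [sub_nonneg, ht, div_le_one hy']; linarith
    have hs2 : s * (x₁ - x₀) = z 0 - x₀ := div_mul_cancel₀ _ hx'.ne'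
    have ht2 : t * (y₁ - y₀) = z 1 - y₀ := div_mul_cancel₀ _ hy'.ne'
    have hC := convex_convexHull ℝ ({!₂[x₀, y₀], !₂[x₁, y₀], !₂[x₀, y₁], !₂[x₁, y₁]} : Set Plane)
    have hsub := subset_convexHull ℝ
      ({!₂[x₀, y₀], !₂[x₁, y₀], !₂[x₀, y₁], !₂[x₁, y₁]} : Set Plane)
    have hb := hC (hsub (by simp : !₂[x₀, y₀] ∈ _)) (hsub (by simp : !₂[x₁, y₀] ∈ _)) hs1 hs0
      (by ring)
    have hu := hC (hsub (by simp : !₂[x₀, y₁] ∈ _)) (hsub (by simp : !₂[x₁, y₁] ∈ _)) hs1 hs0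
      (by ring)
    have h := hC hb hu ht1 ht0 (by ring)
    have hz : z = (1 - t) • ((1 - s) • (!₂[x₀, y₀] : Plane) + s • !₂[x₁, y₀]) +
        t • ((1 - s) • !₂[x₀, y₁] + s • !₂[x₁, y₁]) := by
      ext i
      fin_cases i
      · simp
        linear_combination -hs2
      · simp
        linear_combination -ht2
    rw [rect, hz]
    exact h

theorem openBox_subset_interior_rect {x₀ x₁ y₀ y₁ : ℝ} (hx : x₀ < x₁) (hy : y₀ < y₁) :
    {z : Plane | (x₀ < z 0 ∧ z 0 < x₁) ∧ y₀ < z 1 ∧ z 1 < y₁} ⊆ interior (rect x₀ x₁ y₀ y₁) := by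
  refine interior_maximal ?_ ?_
  · rintro z ⟨⟨h1, h2⟩, h3, h4⟩
    exact (mem_rect_iff hx hy z).2 ⟨⟨h1.le, h2.le⟩, h3.le, h4.le⟩
  · have c0 : Continuous fun z : Plane => z 0 := by fun_prop
    have c1 : Continuous fun z : Plane => z 1 := by fun_prop
    exact ((isOpen_lt continuous_const c0).inter (isOpen_lt c0 continuous_const)).inter
      ((isOpen_lt continuous_const c1).inter (isOpen_lt c1 continuous_const))

theorem isConvexPolygon_rect {x₀ x₁ y₀ y₁ : ℝ} (hx : x₀ < x₁) (hy : y₀ < y₁) :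
    IsConvexPolygon (rect x₀ x₁ y₀ y₁) := by
  classical
  refine ⟨⟨{!₂[x₀, y₀], !₂[x₁, y₀], !₂[x₀, y₁], !₂[x₁, y₁]}, by simp [rect]⟩,
    ⟨!₂[(x₀ + x₁) / 2, (y₀ + y₁) / 2], openBox_subset_interior_rect hx hy ?_⟩⟩
  simp only [mem_ofPred_eq, Matrix.cons_val_zero, Matrix.cons_val_one]
  refine ⟨⟨?_, ?_⟩, ?_, ?_⟩ <;> linarith

/-! ### The environment -/

/-- The measurements of the environment. It consists of levels, stacked in the direction of the
second coordinate. Level `n` is periodic in the first coordinate with period `e / 9 ^ n`, and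
consists of `N` storeys of height `5 * v n`. -/
structure Layout where
  /-- the horizontal period of the lowest level -/
  e : ℝ
  /-- the number of storeys of each level -/
  N : ℕ
  /-- the vertical unit of each level -/
  v : ℕ → ℝ
  e_pos : 0 < e
  one_le_N : 1 ≤ N
  v_zero_pos : 0 < v 0
  v_zero_le : ∀ n, v 0 ≤ v n
  v_succ_le : ∀ n, v (n + 1) ≤ 2 * v n
  e_le : e ≤ v 0

/-- The rectangles `(ξ₀, ξ₁, η₀, η₁)` out of which the obstacles of one cell of a level with `N`
storeys are composed, in a scale in which the cell has width `9` and the storeys have height `5`.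
The six families are the wall around the left edge of the cell (its right edge is the left edge of
the next cell), the solid block between the rails above the level, the wall on the inner side of
the left rail and that of the right rail (each with a door at the bottom of each storey), the
floors between the storeys, and the wall in the middle of each storey but the lowest (with a door
at the top). The rails are the columns from `1` to `2` and from `7` to `8`. The families are
infinite upwards: above the top of the level they are swallowed by the solid block, except for
the walls around the edges, which are needed there. -/
def shape (N : ℕ) : Fin 6 → ℕ → ℝ × ℝ × ℝ × ℝ
  | 0, k => (-1, 1, k - 1, k + 1)
  | 1, k => (2, 7, 5 * N - 1 + k, 5 * N + 1 + k)
  | 2, k => (2, 3, 5 * k + 1, 5 * k + 5)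
  | 3, k => (6, 7, 5 * k + 1, 5 * k + 5)
  | 4, k => (2, 7, 5 * k + 3, 5 * k + 5)
  | 5, k => (4, 5, 5 * k + 4, 5 * k + 7)

theorem shape_bounds (N : ℕ) (s : Fin 6) (k : ℕ) :
    -1 ≤ (shape N s k).1 ∧ (shape N s k).1 < (shape N s k).2.1 ∧ (shape N s k).2.1 ≤ 7 ∧
      (k : ℝ) - 1 ≤ (shape N s k).2.2.1 ∧ (shape N s k).2.2.1 < (shape N s k).2.2.2 := by
  have hk : (0 : ℝ) ≤ k := k.cast_nonneg
  have hN : (0 : ℝ) ≤ N := N.cast_nonneg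
  fin_cases s <;> simp only [shape] <;> refine ⟨?_, ?_, ?_, ?_, ?_⟩ <;> linarith

/-- The point with cell coordinates `ξ`, `η` is not inside any of the obstacles of its cell. -/
def Clear (N : ℕ) (ξ η : ℝ) : Prop :=
  ∀ s k, ¬ (((shape N s k).1 < ξ ∧ ξ < (shape N s k).2.1) ∧
    (shape N s k).2.2.1 < η ∧ η < (shape N s k).2.2.2)

/-- The point with cell coordinates `ξ`, `η` does not touch any of the obstacles of its cell, and
it is between the walls around the edges of the cell. -/
def Inside (N : ℕ) (ξ η : ℝ) : Prop :=
  (1 < ξ ∧ ξ < 8) ∧ ∀ s k, ¬ (((shape N s k).1 ≤ ξ ∧ ξ ≤ (shape N s k).2.1) ∧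
    (shape N s k).2.2.1 ≤ η ∧ η ≤ (shape N s k).2.2.2)

namespace Layout

variable (G : Layout)

/-- The width of the cells of level `n`. -/
noncomputable def len (n : ℕ) : ℝ := G.e / 9 ^ n

/-- The height at which level `n` begins. -/
def base : ℕ → ℝ
  | 0 => 0
  | n + 1 => base n + 5 * G.N * G.v n

/-- The horizontal coordinate of `x` with respect to the cell number `m` of level `n`: it is `0` on
the left edge and `9` on the right edge of the cell. -/
noncomputable def hc (n : ℕ) (m : ℤ) (x : ℝ) : ℝ := 9 * (x / G.len n - m)

/-- The vertical coordinate of `y` with respect to level `n`: it is `0` at the bottom and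
`5 * G.N` at the top of the level. -/
noncomputable def vc (n : ℕ) (y : ℝ) : ℝ := (y - G.base n) / G.v n

/-- The obstacles: copies of the shapes in all cells of all levels. -/
noncomputable def obstacle (i : Fin 6 × ℕ × ℤ × ℕ) : Set Plane :=
  rect (G.len i.2.1 * (i.2.2.1 + (shape G.N i.1 i.2.2.2).1 / 9))
    (G.len i.2.1 * (i.2.2.1 + (shape G.N i.1 i.2.2.2).2.1 / 9))
    (G.base i.2.1 + G.v i.2.1 * (shape G.N i.1 i.2.2.2).2.2.1)
    (G.base i.2.1 + G.v i.2.1 * (shape G.N i.1 i.2.2.2).2.2.2)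

/-- The free space of the environment. -/
noncomputable def free : Set Plane := (interior (⋃ i, G.obstacle i))ᶜ

theorem v_pos (n : ℕ) : 0 < G.v n := G.v_zero_pos.trans_le (G.v_zero_le n)

theorem len_pos (n : ℕ) : 0 < G.len n := div_pos G.e_pos (by positivity)

theorem len_succ (n : ℕ) : G.len (n + 1) = G.len n / 9 := by
  simp only [len, pow_succ]
  field_simp

theorem one_le_N' : (1 : ℝ) ≤ G.N := by exact_mod_cast G.one_le_N

theorem base_add_le (n : ℕ) : G.base n + 5 * G.v n ≤ G.base (n + 1) := by
  have := G.v_pos n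
  have := G.one_le_N'
  simp only [base]
  nlinarith

theorem base_mono : Monotone G.base :=
  monotone_nat_of_le_succ fun n => by linarith [G.base_add_le n, G.v_pos n]

theorem base_strictMono : StrictMono G.base :=
  strictMono_nat_of_lt_succ fun n => by linarith [G.base_add_le n, G.v_pos n]

theorem base_nonneg (n : ℕ) : 0 ≤ G.base n := G.base_mono n.zero_le

theorem mul_v_zero_le_base (n : ℕ) : n * G.v 0 ≤ G.base n := by
  induction n with
  | zero => simp [base]
  | succ n ih =>
    push_cast
    linarith [G.base_add_le n, G.v_zero_le n, G.v_zero_pos]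

theorem base_le_base_succ_sub (n : ℕ) : G.base n < G.base (n + 1) - G.v (n + 1) := by
  linarith [G.base_add_le n, G.v_succ_le n, G.v_pos n]

theorem le_base_sub (n : ℕ) : (n - 1) * G.v 0 ≤ G.base n - G.v n := by
  cases n with
  | zero => simp [base]
  | succ n =>
    push_cast
    linarith [G.base_le_base_succ_sub n, G.mul_v_zero_le_base n]

theorem vc_mul (n : ℕ) (y : ℝ) : G.v n * G.vc n y = y - G.base n :=
  mul_div_cancel₀ _ (G.v_pos n).ne'

theorem vc_lt_iff {n : ℕ} {y c : ℝ} : G.vc n y < c ↔ y < G.base n + G.v n * c := by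
  rw [vc, div_lt_iff₀ (G.v_pos n)]
  constructor <;> intro h <;> linarith

theorem lt_vc_iff {n : ℕ} {y c : ℝ} : c < G.vc n y ↔ G.base n + G.v n * c < y := by
  rw [vc, lt_div_iff₀ (G.v_pos n)]
  constructor <;> intro h <;> linarith

theorem vc_le_iff {n : ℕ} {y c : ℝ} : G.vc n y ≤ c ↔ y ≤ G.base n + G.v n * c := by
  rw [← not_lt, lt_vc_iff, not_lt]

theorem le_vc_iff {n : ℕ} {y c : ℝ} : c ≤ G.vc n y ↔ G.base n + G.v n * c ≤ y := by
  rw [← not_lt, vc_lt_iff, not_lt]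

theorem hc_lt_iff {n : ℕ} {m : ℤ} {x c : ℝ} : G.hc n m x < c ↔ x < G.len n * (m + c / 9) := by
  have : G.hc n m x < c ↔ x / G.len n < m + c / 9 := by
    simp only [hc]
    constructor <;> intro h <;> linarith
  rw [this, div_lt_iff₀ (G.len_pos n), mul_comm]

theorem lt_hc_iff {n : ℕ} {m : ℤ} {x c : ℝ} : c < G.hc n m x ↔ G.len n * (m + c / 9) < x := by
  have : c < G.hc n m x ↔ m + c / 9 < x / G.len n := by
    simp only [hc]
    constructor <;> intro h <;> linarith
  rw [this, lt_div_iff₀ (G.len_pos n), mul_comm]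

theorem hc_le_iff {n : ℕ} {m : ℤ} {x c : ℝ} : G.hc n m x ≤ c ↔ x ≤ G.len n * (m + c / 9) := by
  rw [← not_lt, lt_hc_iff, not_lt]

theorem le_hc_iff {n : ℕ} {m : ℤ} {x c : ℝ} : c ≤ G.hc n m x ↔ G.len n * (m + c / 9) ≤ x := by
  rw [← not_lt, hc_lt_iff, not_lt]

theorem obstacle_corners (i : Fin 6 × ℕ × ℤ × ℕ) :
    G.len i.2.1 * (i.2.2.1 + (shape G.N i.1 i.2.2.2).1 / 9) <
      G.len i.2.1 * (i.2.2.1 + (shape G.N i.1 i.2.2.2).2.1 / 9) ∧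
    G.base i.2.1 + G.v i.2.1 * (shape G.N i.1 i.2.2.2).2.2.1 <
      G.base i.2.1 + G.v i.2.1 * (shape G.N i.1 i.2.2.2).2.2.2 := by
  obtain ⟨-, h1, -, -, h2⟩ := shape_bounds G.N i.1 i.2.2.2
  have := mul_lt_mul_of_pos_left h2 (G.v_pos i.2.1)
  exact ⟨mul_lt_mul_of_pos_left (by linarith) (G.len_pos _), by linarith⟩

theorem mem_obstacle_iff (s : Fin 6) (n : ℕ) (m : ℤ) (k : ℕ) (z : Plane) :
    z ∈ G.obstacle (s, n, m, k) ↔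
      ((shape G.N s k).1 ≤ G.hc n m (z 0) ∧ G.hc n m (z 0) ≤ (shape G.N s k).2.1) ∧
      (shape G.N s k).2.2.1 ≤ G.vc n (z 1) ∧ G.vc n (z 1) ≤ (shape G.N s k).2.2.2 := by
  obtain ⟨h1, h2⟩ := G.obstacle_corners (s, n, m, k)
  rw [obstacle, mem_rect_iff h1 h2, le_hc_iff, hc_le_iff, le_vc_iff, vc_le_iff]

theorem clear_of_mem_free {z : Plane} (hz : z ∈ G.free) (n : ℕ) (m : ℤ) :
    Clear G.N (G.hc n m (z 0)) (G.vc n (z 1)) := by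
  intro s k h
  obtain ⟨h1, h2⟩ := G.obstacle_corners (s, n, m, k)
  refine hz (interior_mono (subset_iUnion G.obstacle (s, n, m, k))
    (openBox_subset_interior_rect h1 h2 ?_))
  rw [lt_hc_iff, hc_lt_iff, lt_vc_iff, vc_lt_iff] at h
  exact h

theorem mem_free_of_inside {z : Plane}
    (h : ∀ n, G.vc n (z 1) < -1 ∨ ∃ m : ℤ, Inside G.N (G.hc n m (z 0)) (G.vc n (z 1))) :
    z ∈ G.free := by
  intro hz
  obtain ⟨⟨s, n, m, k⟩, hz⟩ := mem_iUnion.1 (interior_subset hz)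
  rw [mem_obstacle_iff] at hz
  obtain ⟨b1, -, b2, b3, -⟩ := shape_bounds G.N s k
  obtain ⟨⟨h1, h2⟩, h3, h4⟩ := hz
  rcases h n with h | ⟨m', ⟨i1, i2⟩, i3⟩
  · have : (0 : ℝ) ≤ k := k.cast_nonneg
    linarith
  · have e : G.hc n m (z 0) = G.hc n m' (z 0) + 9 * ((m' - m : ℤ) : ℝ) := by
      simp only [hc]
      push_cast
      ring
    rcases lt_trichotomy m' m with hlt | rfl | hlt
    · have : ((m' - m : ℤ) : ℝ) ≤ -1 := by exact_mod_cast (by omega : m' - m ≤ -1)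
      linarith
    · exact i3 s k ⟨⟨h1, h2⟩, h3, h4⟩
    · have : (1 : ℝ) ≤ ((m' - m : ℤ) : ℝ) := by exact_mod_cast (by omega : 1 ≤ m' - m)
      linarith

theorem locallyFinite_obstacle : LocallyFinite G.obstacle := by
  intro p
  refine ⟨Metric.ball p 1, Metric.ball_mem_nhds p one_pos, ?_⟩
  set R := ‖p‖ + 1 with hR
  set K := ⌈R / G.v 0 + 1⌉₊ with hK
  set M := ⌈R / G.len K + 1⌉ with hM
  refine ((finite_univ (α := Fin 6)).prod ((finite_Iic K).prod
    ((finite_Icc (-M) M).prod (finite_Iic K)))).subset ?_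
  rintro ⟨s, n, m, k⟩ ⟨z, hz, hzp⟩
  have hzR : ‖z‖ ≤ R := by
    have h1 : ‖z - p‖ < 1 := by simpa [dist_eq_norm] using hzp
    have h2 := norm_le_norm_add_norm_sub' z p
    linarith
  have hc0 : |z 0| ≤ R := (PiLp.norm_apply_le z 0).trans hzR
  have hc1 : |z 1| ≤ R := (PiLp.norm_apply_le z 1).trans hzR
  rw [abs_le] at hc0 hc1
  rw [mem_obstacle_iff] at hz
  obtain ⟨b1, -, b2, b3, -⟩ := shape_bounds G.N s k
  obtain ⟨⟨h1, h2⟩, h3, -⟩ := hz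
  have h5 := G.le_vc_iff.1 (b3.trans h3)
  have h6 := G.le_base_sub n
  have h7 : G.v 0 * k ≤ G.v n * k := mul_le_mul_of_nonneg_right (G.v_zero_le n) k.cast_nonneg
  have hnk : (n : ℝ) + k ≤ R / G.v 0 + 1 := by
    rw [← sub_le_iff_le_add, le_div_iff₀ G.v_zero_pos]
    linarith
  have hnK : n ≤ K := by
    have := Nat.le_ceil (R / G.v 0 + 1)
    have hk0 : (0 : ℝ) ≤ k := k.cast_nonneg
    exact_mod_cast (by linarith : (n : ℝ) ≤ K)
  have hkK : k ≤ K := by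
    have := Nat.le_ceil (R / G.v 0 + 1)
    have hk0 : (0 : ℝ) ≤ n := n.cast_nonneg
    exact_mod_cast (by linarith : (k : ℝ) ≤ K)
  have hlen : R / G.len n ≤ R / G.len K := by
    refine div_le_div_of_nonneg_left (by positivity) (G.len_pos K) ?_
    exact div_le_div_of_nonneg_left G.e_pos.le (by positivity)
      (pow_le_pow_right₀ (by norm_num) hnK)
  have hx1 : z 0 / G.len n ≤ R / G.len n := div_le_div_of_nonneg_right hc0.2 (G.len_pos n).le
  have hx2 : -(R / G.len n) ≤ z 0 / G.len n := by
    rw [← neg_div]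
    exact div_le_div_of_nonneg_right hc0.1 (G.len_pos n).le
  have hMle := Int.le_ceil (R / G.len K + 1)
  simp only [hc] at h1 h2
  have hm1 : m ≤ M := by exact_mod_cast (by linarith : (m : ℝ) ≤ M)
  have hm2 : -M ≤ m := by
    have : (-M : ℝ) ≤ m := by linarith
    exact_mod_cast this
  exact ⟨mem_univ _, hnK, ⟨hm2, hm1⟩, hkK⟩

theorem isPolygonalEnvironment_free : IsPolygonalEnvironment G.free :=
  ⟨_, G.obstacle, fun i => isConvexPolygon_rect (G.obstacle_corners i).1 (G.obstacle_corners i).2,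
    G.locallyFinite_obstacle, rfl⟩

end Layout

/-! ### The potential of one cell -/

/-- The restrictions that the obstacles of a cell, apart from the walls around its edges, impose on
a point with cell coordinates `ξ`, `η`. They are invariant under the reflection of the cell. -/
structure Admissible (N : ℕ) (ξ η : ℝ) : Prop where
  top : 2 < ξ → ξ < 7 → η ≤ 5 * N - 1
  left : 2 < ξ → ξ < 3 → ∀ k : ℕ, η ≤ 5 * k + 1 ∨ 5 * k + 5 ≤ η
  right : 6 < ξ → ξ < 7 → ∀ k : ℕ, η ≤ 5 * k + 1 ∨ 5 * k + 5 ≤ η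
  floor : 2 < ξ → ξ < 7 → ∀ k : ℕ, η ≤ 5 * k + 3 ∨ 5 * k + 5 ≤ η
  mid : 4 < ξ → ξ < 5 → ∀ k : ℕ, η ≤ 5 * k + 4 ∨ 5 * k + 7 ≤ η

/-- The open intervals of length `2` with integral centres overlap, so that walls composed of pieces
of height `2` have no gaps. -/
theorem exists_nat_lt_le {a : ℝ} (ha : 0 < a) : ∃ k : ℕ, (k : ℝ) < a ∧ a ≤ k + 1 := by
  obtain ⟨k, hk⟩ : ∃ k, ⌈a⌉₊ = k + 1 := Nat.exists_eq_succ_of_ne_zero (Nat.ceil_pos.2 ha).ne'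
  refine ⟨k, ?_, ?_⟩
  · exact Nat.lt_ceil.1 (by omega)
  · have := Nat.le_ceil a
    rw [hk] at this
    exact_mod_cast this

theorem Clear.admissible {N : ℕ} {ξ η : ℝ} (h : Clear N ξ η) : Admissible N ξ η where
  top h1 h2 := by
    by_contra! hlt
    obtain ⟨k, hk, hk'⟩ := exists_nat_lt_le (sub_pos.2 hlt)
    exact h 1 k ⟨⟨h1, h2⟩, by simp only [shape]; linarith, by simp only [shape]; linarith⟩
  left h1 h2 k := by
    by_contra! hk
    exact h 2 k ⟨⟨h1, h2⟩, hk⟩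
  right h1 h2 k := by
    by_contra! hk
    exact h 3 k ⟨⟨h1, h2⟩, hk⟩
  floor h1 h2 k := by
    by_contra! hk
    exact h 4 k ⟨⟨h1, h2⟩, hk⟩
  mid h1 h2 k := by
    by_contra! hk
    exact h 5 k ⟨⟨h1, h2⟩, hk⟩

theorem Clear.edge {N : ℕ} {ξ η : ℝ} (h : Clear N ξ η) (hη : -1 < η) (h1 : -1 < ξ) : 1 ≤ ξ := by
  by_contra! h2
  obtain ⟨k, hk, hk'⟩ := exists_nat_lt_le (by linarith : 0 < η + 1)
  exact h 0 k ⟨⟨h1, h2⟩, by simp only [shape]; linarith, by simp only [shape]; linarith⟩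

/-- The reflection of a cell that exchanges its two rails, applied if `β` is `true`. -/
def mirror (β : Bool) (ξ : ℝ) : ℝ := if β then 9 - ξ else ξ

theorem Admissible.mirror {N : ℕ} {ξ η : ℝ} (h : Admissible N ξ η) (β : Bool) :
    Admissible N (mirror β ξ) η := by
  cases β
  · exact h
  · simp only [Tracking.mirror, if_true]
    constructor
    · exact fun h1 h2 => h.top (by linarith) (by linarith)
    · exact fun h1 h2 => h.right (by linarith) (by linarith)
    · exact fun h1 h2 => h.left (by linarith) (by linarith)
    · exact fun h1 h2 => h.floor (by linarith) (by linarith)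
    · exact fun h1 h2 => h.mid (by linarith) (by linarith)

/-- The function that is `0` up to `1`, rises with slope `2` to the value `2`, and stays there. -/
noncomputable def rise (η : ℝ) : ℝ := max 0 (min (2 * (η - 1)) 2)

theorem rise_nonneg (η : ℝ) : 0 ≤ rise η := le_max_left _ _

theorem rise_of_le {η : ℝ} (h : η ≤ 1) : rise η = 0 :=
  max_eq_left ((min_le_left _ _).trans (by linarith))

theorem rise_of_ge {η : ℝ} (h : 2 ≤ η) : rise η = 2 := by
  rw [rise, min_eq_right (by linarith), max_eq_right (by norm_num)]

theorem abs_sub_rise_le (η η' c : ℝ) :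
    |(η - rise (η - c)) - (η' - rise (η' - c))| ≤ |η - η'| := by
  simp only [rise, max_def, min_def]
  split_ifs <;> rw [abs_le] <;> cases abs_cases (η - η') <;> constructor <;> linarith

/-- The potential of a cell whose target rail is the one on the left. On the target rail, it is the
height. On the other rail, it is the height minus `2`, except that near the bottom the way back to
the fork is shorter, and it does not increase above the top of the cell. The storeys between the
rails interpolate: in the chamber next to the target rail, one has to go down to get there. -/
noncomputable def cellPot (N : ℕ) (ξ η : ℝ) : ℝ :=
  if ξ < 5 / 2 then η
  else if ξ < 9 / 2 then η - rise (η - 5 * ⌊(η + 1) / 5⌋)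
  else min (η - rise η) (5 * N - 2)

theorem cellPot_le (N : ℕ) (ξ η : ℝ) : cellPot N ξ η ≤ η := by
  unfold cellPot
  split_ifs
  · exact le_rfl
  · linarith [rise_nonneg (η - 5 * ⌊(η + 1) / 5⌋)]
  · exact (min_le_left _ _).trans (by linarith [rise_nonneg η])

theorem cellPot_of_lt_one {N : ℕ} (hN : 1 ≤ N) {ξ η : ℝ} (h0 : -1 < η) (h1 : η < 1) :
    cellPot N ξ η = η := by
  have hN' : (1 : ℝ) ≤ N := by exact_mod_cast hN
  have hf : ⌊(η + 1) / 5⌋ = 0 := Int.floor_eq_zero_iff.2 ⟨by linarith, by linarith⟩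
  unfold cellPot
  rw [hf, rise_of_le h1.le]
  simp only [Int.cast_zero, mul_zero, sub_zero, rise_of_le h1.le]
  rw [min_eq_left (by linarith)]
  simp

theorem storey_bounds (η : ℝ) :
    -1 ≤ η - 5 * ⌊(η + 1) / 5⌋ ∧ η - 5 * ⌊(η + 1) / 5⌋ < 4 := by
  have h1 := Int.floor_le ((η + 1) / 5)
  have h2 := Int.lt_floor_add_one ((η + 1) / 5)
  constructor <;> linarith

theorem exists_storey {η : ℝ} (hη : -1 < η) : ∃ j : ℕ, ⌊(η + 1) / 5⌋ = (j : ℤ) :=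
  Int.eq_ofNat_of_zero_le (Int.floor_nonneg.2 (by linarith))

theorem rise_storey_of_left {N : ℕ} {ξ η : ℝ} (h : Admissible N ξ η) (h1 : 2 < ξ) (h2 : ξ < 3)
    (hη : -1 < η) : rise (η - 5 * ⌊(η + 1) / 5⌋) = 0 := by
  obtain ⟨j, hj⟩ := exists_storey hη
  have hb := storey_bounds η
  rw [hj] at hb ⊢
  push_cast at hb ⊢
  refine rise_of_le ?_
  rcases h.left h1 h2 j with h | h <;> linarith

theorem rise_storey_of_mid {N : ℕ} {ξ η : ℝ} (h : Admissible N ξ η) (h1 : 4 < ξ) (h2 : ξ < 5)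
    (hη : -1 < η) : rise (η - 5 * ⌊(η + 1) / 5⌋) = rise η := by
  obtain ⟨j, hj⟩ := exists_storey hη
  have hb := storey_bounds η
  rw [hj] at hb ⊢
  push_cast at hb ⊢
  cases j with
  | zero => simp
  | succ k =>
    push_cast at hb ⊢
    have hk : (0 : ℝ) ≤ k := k.cast_nonneg
    have hm := h.mid h1 h2 k
    have hf := h.floor (by linarith) (by linarith) k
    have : 5 * (k : ℝ) + 7 ≤ η := by
      rcases hm with hm | hm
      · rcases hf with hf | hf <;> linarith
      · exact hm
    rw [rise_of_ge (by linarith), rise_of_ge (by linarith)]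

theorem min_rise_eq {N : ℕ} (hN : 1 ≤ N) {η : ℝ} (h : η ≤ 5 * N) :
    min (η - rise η) (5 * N - 2) = η - rise η := by
  have hN' : (1 : ℝ) ≤ N := by exact_mod_cast hN
  refine min_eq_left ?_
  rcases le_total η 2 with h2 | h2
  · linarith [rise_nonneg η]
  · rw [rise_of_ge h2]
    linarith

/-- The potential of a cell is, near each admissible point, a 1-Lipschitz function of the height:
the values on the two sides of a door agree. -/
theorem cellPot_local {N : ℕ} (hN : 1 ≤ N) {ξ₀ η₀ : ℝ} (hη : -1 < η₀)
    (h₀ : Admissible N ξ₀ η₀) :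
    ∃ ε > 0, ∀ ξ η, |ξ - ξ₀| < ε → |η - η₀| < ε → Admissible N ξ η →
      |cellPot N ξ η - cellPot N ξ₀ η₀| ≤ |η - η₀| := by
  have hr := fun η η' => abs_sub_rise_le η η' 0
  simp only [sub_zero] at hr
  rcases lt_trichotomy ξ₀ (5 / 2) with h1 | h1 | h1
  · refine ⟨5 / 2 - ξ₀, by linarith, fun ξ η hξ _ _ => ?_⟩
    rw [abs_lt] at hξ
    rw [cellPot, cellPot, if_pos (by linarith), if_pos h1]
  · -- in the doors of the wall next to the left rail, both formulas give the height
    have key : ∀ ξ η, |ξ - ξ₀| < 1 / 2 → -1 < η → Admissible N ξ η → cellPot N ξ η = η := by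
      intro ξ η hξ hη hA
      rw [abs_lt] at hξ
      rw [cellPot, rise_storey_of_left hA (by linarith) (by linarith) hη,
        if_pos (by linarith : ξ < 9 / 2)]
      simp
    refine ⟨min (1 / 2) (η₀ + 1), lt_min (by norm_num) (by linarith), fun ξ η hξ hd hA => ?_⟩
    have hd' := (abs_lt.1 (hd.trans_le (min_le_right _ _))).1
    rw [key ξ η (hξ.trans_le (min_le_left _ _)) (by linarith) hA,
      key ξ₀ η₀ (by simp) hη h₀]
  rcases lt_trichotomy ξ₀ (9 / 2) with h2 | h2 | h2
  · obtain ⟨j, hj⟩ := exists_storey hη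
    have hb := storey_bounds η₀
    rw [hj] at hb
    push_cast at hb
    -- the discontinuities at the heights `5 * j - 1` are inside the floors
    have hne : 5 * (j : ℝ) - 1 < η₀ := by
      refine lt_of_le_of_ne (by linarith) fun heq => ?_
      cases j with
      | zero => norm_num at heq; linarith
      | succ k =>
        push_cast at heq
        rcases h₀.floor (by linarith) (by linarith) k with h | h <;> linarith
    have key : ∀ ξ η, 5 / 2 < ξ → ξ < 9 / 2 → 5 * (j : ℝ) - 1 < η → η < 5 * j + 4 →
        cellPot N ξ η = η - rise (η - 5 * j) := by
      intro ξ η h3 h4 h5 h6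
      have : ⌊(η + 1) / 5⌋ = (j : ℤ) := by
        rw [Int.floor_eq_iff]
        push_cast
        constructor <;> linarith
      rw [cellPot, if_neg (by linarith), if_pos h4, this]
      push_cast
      rfl
    refine ⟨min (min (ξ₀ - 5 / 2) (9 / 2 - ξ₀)) (min (η₀ - (5 * j - 1)) (5 * j + 4 - η₀)),
      lt_min (lt_min (by linarith) (by linarith)) (lt_min (by linarith) (by linarith)),
      fun ξ η hξ hd _ => ?_⟩
    simp only [lt_min_iff, abs_lt] at hξ hd
    rw [key ξ η (by linarith) (by linarith) (by linarith) (by linarith),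
      key ξ₀ η₀ h1 h2 hne (by linarith)]
    exact abs_sub_rise_le _ _ _
  · -- in the doors of the middle wall, at the top of a storey, the full penalty is reached
    have key : ∀ ξ η, |ξ - ξ₀| < 1 / 2 → -1 < η → Admissible N ξ η →
        cellPot N ξ η = η - rise η := by
      intro ξ η hξ hη hA
      rw [abs_lt] at hξ
      have := hA.top (by linarith) (by linarith)
      rw [cellPot, rise_storey_of_mid hA (by linarith) (by linarith) hη,
        min_rise_eq hN (by linarith), if_neg (by linarith)]
      simp
    refine ⟨min (1 / 2) (η₀ + 1), lt_min (by norm_num) (by linarith), fun ξ η hξ hd hA => ?_⟩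
    have hd' := (abs_lt.1 (hd.trans_le (min_le_right _ _))).1
    rw [key ξ η (hξ.trans_le (min_le_left _ _)) (by linarith) hA,
      key ξ₀ η₀ (by simp) hη h₀]
    exact hr _ _
  · refine ⟨ξ₀ - 9 / 2, by linarith, fun ξ η hξ _ _ => ?_⟩
    rw [abs_lt] at hξ
    rw [cellPot, cellPot, if_neg (by linarith), if_neg (by linarith), if_neg (by linarith),
      if_neg (by linarith)]
    refine (abs_min_sub_min_le_max _ _ _ _).trans (max_le (hr _ _) ?_)
    simp

/-! ### The tree of rails -/

namespace Layout

variable (G : Layout)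

/-- The number of the cell of level `n` that is reached by the sequence `b` of choices: the cells
of level `n + 1` are the nine columns of the cells of level `n`, of which number `1` and number `7`
are the rails. -/
def cell (b : ℕ → Bool) : ℕ → ℤ
  | 0 => 0
  | n + 1 => 9 * cell b n + if b n then 7 else 1

theorem cell_congr {b b' : ℕ → Bool} {n : ℕ} (h : ∀ j < n, b j = b' j) : cell b n = cell b' n := by
  induction n with
  | zero => rfl
  | succ n ih => rw [cell, cell, ih fun j hj => h j (by omega), h n (by omega)]

theorem hc_succ (b : ℕ → Bool) (n : ℕ) (x : ℝ) :
    G.hc (n + 1) (cell b (n + 1)) x = 9 * (G.hc n (cell b n) x - if b n then 7 else 1) := by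
  have := (G.len_pos n).ne'
  simp only [hc, cell, len_succ]
  cases b n <;> · simp; field_simp; ring

theorem hc_add_one (n : ℕ) (m : ℤ) (x : ℝ) : G.hc n (m + 1) x = G.hc n m x - 9 := by
  simp only [hc]
  push_cast
  ring

/-- The points with a first coordinate strictly inside the cell of level `n` selected by `b`. -/
def InTube (b : ℕ → Bool) (n : ℕ) (z : Plane) : Prop :=
  0 < G.hc n (cell b n) (z 0) ∧ G.hc n (cell b n) (z 0) < 9

theorem InTube.of_succ {G : Layout} {b : ℕ → Bool} {n : ℕ} {z : Plane}
    (h : G.InTube b (n + 1) z) : G.InTube b n z := by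
  obtain ⟨h1, h2⟩ := h
  rw [hc_succ] at h1 h2
  constructor <;> split_ifs at h1 h2 <;> linarith

theorem InTube.mirror_lt {G : Layout} {b : ℕ → Bool} {n : ℕ} {z : Plane}
    (h : G.InTube b (n + 1) z) : mirror (b n) (G.hc n (cell b n) (z 0)) < 2 := by
  obtain ⟨h1, h2⟩ := h
  rw [hc_succ] at h1 h2
  unfold mirror
  split_ifs at h1 h2 ⊢ <;> linarith

open Classical in
/-- The potential of a point with respect to the first `n` choices of the sequence `b`. It is the
height in the tube of these choices, and its difference to the height of a point in the tube, above
the bottom of level `n`, is a lower bound for the distance to that point. Above the bottom of a cell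
that is selected by `b`, it is given by `cellPot`, with the cell reflected if the target rail is
the one on the right; outside the tube of level `0` it does not exceed `0`. -/
noncomputable def pot (b : ℕ → Bool) : ℕ → Plane → ℝ
  | 0, z => if G.InTube b 0 z then z 1 else min (z 1) 0
  | n + 1, z =>
    if G.base n ≤ z 1 ∧ G.InTube b n z then
      G.base n + G.v n * cellPot G.N (mirror (b n) (G.hc n (cell b n) (z 0))) (G.vc n (z 1))
    else pot b n z

theorem inTube_congr {b b' : ℕ → Bool} {n : ℕ} (h : ∀ j < n, b j = b' j) (z : Plane) :
    G.InTube b n z ↔ G.InTube b' n z := by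
  rw [InTube, InTube, cell_congr h]

theorem pot_congr {b b' : ℕ → Bool} {n : ℕ} (h : ∀ j < n, b j = b' j) (z : Plane) :
    G.pot b n z = G.pot b' n z := by
  induction n with
  | zero => rfl
  | succ n ih =>
    have h' : ∀ j < n, b j = b' j := fun j hj => h j (by omega)
    have hI := G.inTube_congr h' z
    rw [pot, pot, cell_congr h', h n (by omega), ih h']
    by_cases hz : G.base n ≤ z 1 ∧ G.InTube b n z
    · rw [if_pos hz, if_pos (by rwa [← hI])]
    · rw [if_neg hz, if_neg (by rwa [← hI])]

theorem pot_le (b : ℕ → Bool) (n : ℕ) (z : Plane) : G.pot b n z ≤ z 1 := by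
  induction n with
  | zero =>
    rw [pot]
    split_ifs
    · exact le_rfl
    · exact min_le_left _ _
  | succ n ih =>
    rw [pot]
    split_ifs
    · have := mul_le_mul_of_nonneg_left
        (cellPot_le G.N (mirror (b n) (G.hc n (cell b n) (z 0))) (G.vc n (z 1))) (G.v_pos n).le
      rw [vc_mul] at this
      linarith
    · exact ih

theorem pot_succ_of_inTube {b : ℕ → Bool} {n : ℕ} {z : Plane} (h : G.InTube b (n + 1) z)
    (hz : G.base n ≤ z 1) : G.pot b (n + 1) z = z 1 := by
  rw [pot, if_pos ⟨hz, h.of_succ⟩, cellPot, if_pos (by linarith [h.mirror_lt]), vc_mul]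
  ring

theorem pot_of_inTube {b : ℕ → Bool} {n : ℕ} {z : Plane} (h : G.InTube b n z)
    (hz : G.base n ≤ z 1) : G.pot b n z = z 1 := by
  cases n with
  | zero => rw [pot, if_pos h]
  | succ n => exact G.pot_succ_of_inTube h ((G.base_mono n.le_succ).trans hz)

theorem one_le_hc {z : Plane} (hz : z ∈ G.free) {n : ℕ} {m : ℤ} (h : G.base n ≤ z 1)
    (h0 : -1 < G.hc n m (z 0)) : 1 ≤ G.hc n m (z 0) := by
  refine (G.clear_of_mem_free hz n m).edge ?_ h0
  rw [lt_vc_iff]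
  linarith [G.v_pos n]

theorem hc_le_eight {z : Plane} (hz : z ∈ G.free) {n : ℕ} {m : ℤ} (h : G.base n ≤ z 1)
    (h0 : G.hc n m (z 0) < 10) : G.hc n m (z 0) ≤ 8 := by
  by_contra! h1
  have h2 := G.one_le_hc hz (m := m + 1) h (by rw [hc_add_one]; linarith)
  rw [hc_add_one] at h2
  linarith

/-- The only points of high potential are those in the tube, above its bottom. -/
theorem pot_le_base {b : ℕ → Bool} {n : ℕ} {z : Plane} (hz : z ∈ G.free)
    (h : ¬ (G.base n ≤ z 1 ∧ G.InTube b n z)) : G.pot b n z ≤ G.base n := by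
  induction n with
  | zero =>
    rw [pot]
    split_ifs with h0
    · exact (not_le.1 fun h1 => h ⟨h1, h0⟩).le
    · exact min_le_right _ _
  | succ n ih =>
    rcases lt_or_ge (z 1) (G.base (n + 1)) with h1 | h1
    · exact (G.pot_le b _ z).trans h1.le
    rw [pot]
    split_ifs with h2
    · have hn : ¬ G.InTube b (n + 1) z := fun h3 => h ⟨h1, h3⟩
      set ξ := G.hc n (cell b n) (z 0) with hξ
      have hA := (G.clear_of_mem_free hz n (cell b n)).admissible.mirror (b n)
      have hT : 5 * (G.N : ℝ) ≤ G.vc n (z 1) := by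
        rw [le_vc_iff]
        simp only [base] at h1
        linarith
      have e0 : 1 ≤ ξ := G.one_le_hc hz h2.1 (by linarith [h2.2.1])
      have e1 : ξ ≤ 8 := G.hc_le_eight hz h2.1 (by linarith [h2.2.2])
      have f0 := G.one_le_hc hz (m := cell b (n + 1)) h1
      have f1 := G.hc_le_eight hz (m := cell b (n + 1)) h1
      have hge : 7 ≤ mirror (b n) ξ := by
        by_contra! hlt
        have hle : mirror (b n) ξ ≤ 2 := by
          by_contra! hgt
          linarith [hA.top hgt hlt]
        apply hn
        rw [InTube, hc_succ]
        rw [hc_succ] at f0 f1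
        rw [← hξ] at f0 f1 ⊢
        unfold mirror at hle hlt
        split_ifs at hle hlt f0 f1 ⊢
        · exact ⟨by linarith [f0 (by linarith)], by linarith [f1 (by linarith)]⟩
        · exact ⟨by linarith [f0 (by linarith)], by linarith [f1 (by linarith)]⟩
      have hc : cellPot G.N (mirror (b n) ξ) (G.vc n (z 1)) ≤ 5 * G.N := by
        rw [cellPot, if_neg (by linarith), if_neg (by linarith)]
        exact (min_le_right _ _).trans (by linarith)
      have := mul_le_mul_of_nonneg_left hc (G.v_pos n).le
      simp only [base]
      linarith
    · exact (ih h2).trans (G.base_mono n.le_succ)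

/-- For one of the two possible next choices, the potential drops by `2 * v n`, unless the point
is close to the fork or below it. -/
theorem exists_pot_succ_le (b : ℕ → Bool) {n : ℕ} {z : Plane} (hz : z ∈ G.free) :
    ∃ β, G.pot (Function.update b n β) (n + 1) z ≤
      max (G.base n + 2 * G.v n) (G.pot b n z - 2 * G.v n) := by
  have hcong : ∀ β, ∀ j < n, Function.update b n β j = b j := fun β j hj =>
    Function.update_of_ne hj.ne _ _
  by_cases h : G.base n ≤ z 1 ∧ G.InTube b n z
  · rw [G.pot_of_inTube h.2 h.1]
    refine ⟨decide (G.hc n (cell b n) (z 0) < 9 / 2), ?_⟩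
    set β := decide (G.hc n (cell b n) (z 0) < 9 / 2) with hβ
    rcases le_total (G.vc n (z 1)) 2 with h2 | h2
    · rw [vc_le_iff] at h2
      exact (G.pot_le _ _ _).trans (le_max_of_le_left (by linarith))
    · refine le_max_of_le_right ?_
      rw [pot, if_pos ⟨h.1, (G.inTube_congr (hcong β) z).2 h.2⟩, Function.update_self,
        cell_congr (hcong β)]
      have hge : 9 / 2 ≤ mirror β (G.hc n (cell b n) (z 0)) := by
        unfold mirror
        simp only [hβ, decide_eq_true_eq]
        split_ifs <;> linarith
      have hc : cellPot G.N (mirror β (G.hc n (cell b n) (z 0))) (G.vc n (z 1)) ≤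
          G.vc n (z 1) - 2 := by
        rw [cellPot, if_neg (by linarith), if_neg (by linarith), rise_of_ge h2]
        exact min_le_left _ _
      have := mul_le_mul_of_nonneg_left hc (G.v_pos n).le
      rw [mul_sub, vc_mul] at this
      linarith
  · refine ⟨false, le_max_of_le_left ?_⟩
    rw [pot, if_neg (by rwa [G.inTube_congr (hcong false)]), G.pot_congr (hcong false)]
    linarith [G.pot_le_base hz h, G.v_pos n]

theorem tendsto_hc (n : ℕ) (m : ℤ) (p : Plane) :
    Tendsto (fun z : Plane => G.hc n m (z 0)) (𝓝[G.free] p) (𝓝 (G.hc n m (p 0))) := by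
  refine Tendsto.mono_left (Continuous.tendsto ?_ p) nhdsWithin_le_nhds
  unfold hc
  fun_prop

theorem tendsto_vc (n : ℕ) (p : Plane) :
    Tendsto (fun z : Plane => G.vc n (z 1)) (𝓝[G.free] p) (𝓝 (G.vc n (p 1))) := by
  refine Tendsto.mono_left (Continuous.tendsto ?_ p) nhdsWithin_le_nhds
  unfold vc
  fun_prop

theorem tendsto_snd (p : Plane) :
    Tendsto (fun z : Plane => z 1) (𝓝[G.free] p) (𝓝 (p 1)) := by
  refine Tendsto.mono_left (Continuous.tendsto ?_ p) nhdsWithin_le_nhds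
  fun_prop

theorem abs_pot_sub_le_of_eventuallyEq {f g : Plane → ℝ} {p : Plane} (hp : p ∈ G.free)
    (h : ∀ᶠ z in 𝓝[G.free] p, f z = g z)
    (hg : ∀ᶠ z in 𝓝[G.free] p, |g z - g p| ≤ |z 1 - p 1|) :
    ∀ᶠ z in 𝓝[G.free] p, |f z - f p| ≤ |z 1 - p 1| := by
  have hfp := h.self_of_nhdsWithin hp
  filter_upwards [h, hg] with z h1 h2
  rwa [h1, hfp]

theorem eventually_abs_pot_sub_le (b : ℕ → Bool) (n : ℕ) {p : Plane} (hp : p ∈ G.free) :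
    ∀ᶠ z in 𝓝[G.free] p, |G.pot b n z - G.pot b n p| ≤ |z 1 - p 1| := by
  induction n with
  | zero =>
    by_cases h : G.base 0 ≤ p 1
    · by_cases hT : G.InTube b 0 p
      · refine G.abs_pot_sub_le_of_eventuallyEq (g := fun z => z 1) hp ?_ (by simp)
        filter_upwards [(G.tendsto_hc 0 (cell b 0) p).eventually_const_lt hT.1,
          (G.tendsto_hc 0 (cell b 0) p).eventually_lt_const hT.2] with z h1 h2
        rw [pot, if_pos ⟨h1, h2⟩]
      · refine G.abs_pot_sub_le_of_eventuallyEq (g := fun z => min (z 1) 0) hp ?_ ?_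
        · have hor : G.hc 0 (cell b 0) (p 0) < 0 ∨ 9 < G.hc 0 (cell b 0) (p 0) := by
            by_contra! hcon
            have h1 := G.one_le_hc hp (m := cell b 0) h (by linarith)
            have h2 := G.hc_le_eight hp (m := cell b 0) h (by linarith)
            exact hT ⟨by linarith, by linarith⟩
          rcases hor with hor | hor
          · filter_upwards [(G.tendsto_hc 0 (cell b 0) p).eventually_lt_const hor] with z h1
            rw [pot, if_neg fun hc => by linarith [hc.1]]
          · filter_upwards [(G.tendsto_hc 0 (cell b 0) p).eventually_const_lt hor] with z h1
            rw [pot, if_neg fun hc => by linarith [hc.2]]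
        · refine Eventually.of_forall fun z => ?_
          refine (abs_min_sub_min_le_max _ _ _ _).trans (max_le le_rfl ?_)
          simp
    · refine G.abs_pot_sub_le_of_eventuallyEq (g := fun z => z 1) hp ?_ (by simp)
      filter_upwards [(G.tendsto_snd p).eventually_lt_const (not_le.1 h)] with z h1
      simp only [base] at h1
      rw [pot, min_eq_left h1.le, ite_self]
  | succ n ih =>
    by_cases h : G.base n ≤ p 1
    · by_cases hT : G.InTube b n p
      · set c := cell b n with hc
        set h' : Plane → ℝ := fun z =>
          G.base n + G.v n * cellPot G.N (mirror (b n) (G.hc n c (z 0))) (G.vc n (z 1)) with hh'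
        have hv : -1 < G.vc n (p 1) := by
          rw [lt_vc_iff]
          linarith [G.v_pos n]
        refine G.abs_pot_sub_le_of_eventuallyEq (g := h') hp ?_ ?_
        · have hlow : ∀ᶠ z in 𝓝[G.free] p, z 1 < G.base n → G.pot b n z = z 1 := by
            cases n with
            | zero =>
              refine Eventually.of_forall fun z hz => ?_
              simp only [base] at hz
              rw [pot, min_eq_left hz.le, ite_self]
            | succ n =>
              have hlt : G.base n < p 1 := (G.base_strictMono n.lt_succ_self).trans_le h
              filter_upwards [(G.tendsto_hc _ c p).eventually_const_lt hT.1,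
                (G.tendsto_hc _ c p).eventually_lt_const hT.2,
                (G.tendsto_snd p).eventually_const_lt hlt] with z h1 h2 h3 _
              exact G.pot_succ_of_inTube ⟨h1, h2⟩ h3.le
          filter_upwards [(G.tendsto_hc n c p).eventually_const_lt hT.1,
            (G.tendsto_hc n c p).eventually_lt_const hT.2,
            (G.tendsto_vc n p).eventually_const_lt hv, hlow] with z h1 h2 h3 h4
          rw [pot]
          split_ifs with hz
          · rfl
          · have hlt : z 1 < G.base n := not_le.1 fun hle => hz ⟨hle, h1, h2⟩
            have : G.vc n (z 1) < 1 := by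
              rw [vc_lt_iff]
              linarith [G.v_pos n]
            simp only [hh']
            rw [h4 hlt, cellPot_of_lt_one G.one_le_N h3 this, vc_mul]
            ring
        · have hA : ∀ z ∈ G.free, Admissible G.N (mirror (b n) (G.hc n c (z 0))) (G.vc n (z 1)) :=
            fun z hz => (G.clear_of_mem_free hz n c).admissible.mirror (b n)
          obtain ⟨ε, hε, hloc⟩ := cellPot_local G.one_le_N hv (hA p hp)
          filter_upwards [(G.tendsto_hc n c p).eventually (Metric.ball_mem_nhds _ hε),
            (G.tendsto_vc n p).eventually (Metric.ball_mem_nhds _ hε),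
            self_mem_nhdsWithin] with z h1 h2 h3
          rw [Real.dist_eq] at h1 h2
          have h4 : |mirror (b n) (G.hc n c (z 0)) - mirror (b n) (G.hc n c (p 0))| < ε := by
            unfold mirror
            split_ifs
            · rwa [sub_sub_sub_cancel_left, abs_sub_comm]
            · exact h1
          have h5 := mul_le_mul_of_nonneg_left (hloc _ _ h4 h2 (hA z h3)) (G.v_pos n).le
          rw [← abs_of_pos (G.v_pos n), ← abs_mul, ← abs_mul, mul_sub,
            mul_sub, vc_mul, vc_mul] at h5
          simpa only [hh', add_sub_add_left_eq_sub, sub_sub_sub_cancel_right] using h5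
      · refine G.abs_pot_sub_le_of_eventuallyEq hp ?_ ih
        have hor : G.hc n (cell b n) (p 0) < 0 ∨ 9 < G.hc n (cell b n) (p 0) := by
          by_contra! hcon
          have h1 := G.one_le_hc hp (m := cell b n) h (by linarith)
          have h2 := G.hc_le_eight hp (m := cell b n) h (by linarith)
          exact hT ⟨by linarith, by linarith⟩
        rcases hor with hor | hor
        · filter_upwards [(G.tendsto_hc n (cell b n) p).eventually_lt_const hor] with z h1
          rw [pot, if_neg fun hc => by linarith [hc.2.1]]
        · filter_upwards [(G.tendsto_hc n (cell b n) p).eventually_const_lt hor] with z h1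
          rw [pot, if_neg fun hc => by linarith [hc.2.2]]
    · refine G.abs_pot_sub_le_of_eventuallyEq hp ?_ ih
      filter_upwards [(G.tendsto_snd p).eventually_lt_const (not_le.1 h)] with z h1
      rw [pot, if_neg fun hc => by linarith [hc.1]]

theorem ofReal_abs_pot_sub_le (b : ℕ → Bool) (n : ℕ) (x y : Plane) :
    ENNReal.ofReal |G.pot b n x - G.pot b n y| ≤ geodesicDist G.free x y := by
  rw [← Real.dist_eq, ← edist_dist]
  refine edist_le_geodesicDist (fun p hp => ?_) x y
  filter_upwards [G.eventually_abs_pot_sub_le b n hp] with z hz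
  rw [edist_dist, edist_dist, Real.dist_eq]
  refine ENNReal.ofReal_le_ofReal (hz.trans ?_)
  rw [dist_eq_norm, ← PiLp.sub_apply, ← Real.norm_eq_abs]
  exact PiLp.norm_apply_le (z - p) 1

end Layout

/-! ### Short paths in the environment -/

theorem geodesicDist_horizontal_le {F : Set Plane} {x x' y : ℝ}
    (h : ∀ u ∈ uIcc x x', (!₂[u, y] : Plane) ∈ F) :
    geodesicDist F !₂[x, y] !₂[x', y] ≤ ENNReal.ofReal |x - x'| := by
  have hd : edist (!₂[x, y] : Plane) !₂[x', y] = ENNReal.ofReal |x - x'| := by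
    rw [edist_dist, EuclideanSpace.dist_eq]
    simp [Real.dist_eq, Real.sqrt_sq_eq_abs]
  rw [← hd]
  refine geodesicDist_le_of_segment ?_
  rintro z ⟨s, t, hs, ht, hst, rfl⟩
  have : s • (!₂[x, y] : Plane) + t • !₂[x', y] = !₂[s • x + t • x', y] := by
    ext i
    fin_cases i
    · simp
    · simp [← add_mul, hst]
  rw [this]
  refine h _ ?_
  rw [← segment_eq_uIcc]
  exact ⟨s, t, hs, ht, hst, rfl⟩

theorem geodesicDist_vertical_le {F : Set Plane} {x y y' : ℝ}
    (h : ∀ u ∈ uIcc y y', (!₂[x, u] : Plane) ∈ F) :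
    geodesicDist F !₂[x, y] !₂[x, y'] ≤ ENNReal.ofReal |y - y'| := by
  have hd : edist (!₂[x, y] : Plane) !₂[x, y'] = ENNReal.ofReal |y - y'| := by
    rw [edist_dist, EuclideanSpace.dist_eq]
    simp [Real.dist_eq, Real.sqrt_sq_eq_abs]
  rw [← hd]
  refine geodesicDist_le_of_segment ?_
  rintro z ⟨s, t, hs, ht, hst, rfl⟩
  have : s • (!₂[x, y] : Plane) + t • !₂[x, y'] = !₂[x, s • y + t • y'] := by
    ext i
    fin_cases i
    · simp [← add_mul, hst]
    · simp
  rw [this]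
  refine h _ ?_
  rw [← segment_eq_uIcc]
  exact ⟨s, t, hs, ht, hst, rfl⟩

theorem inside_of_rail (N : ℕ) {ξ : ℝ} (η : ℝ) (h : (1 < ξ ∧ ξ < 2) ∨ (7 < ξ ∧ ξ < 8)) :
    Inside N ξ η := by
  refine ⟨by rcases h with h | h <;> constructor <;> linarith [h.1, h.2], fun s k => ?_⟩
  rintro ⟨⟨h1, h2⟩, -⟩
  fin_cases s <;> simp only [shape] at h1 h2 <;>
    rcases h with ⟨h, h'⟩ | ⟨h, h'⟩ <;> linarith

theorem inside_of_lt_one {N : ℕ} (hN : 1 ≤ N) {ξ η : ℝ} (h1 : 1 < ξ) (h8 : ξ < 8) (h : η < 1) :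
    Inside N ξ η := by
  have hN' : (1 : ℝ) ≤ N := by exact_mod_cast hN
  refine ⟨⟨h1, h8⟩, fun s k => ?_⟩
  have hk : (0 : ℝ) ≤ k := k.cast_nonneg
  rintro ⟨⟨h1, h2⟩, h3, h4⟩
  fin_cases s <;> simp only [shape] at h1 h2 h3 h4 <;> linarith

/-- The passage between the two rails in storey number `j`. -/
theorem inside_of_storey {N j : ℕ} (hj : j < N) {ξ η : ℝ} (hξ : 1 < ξ ∧ ξ < 8)
    (hη : 5 * j + 1 / 2 ≤ η ∧ η ≤ 5 * (j : ℝ) + 5 / 2)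
    (hside : η < 5 * j + 1 ∨ (3 < ξ ∧ ξ < 6)) (hmid : 5 * j + 2 < η ∨ ξ < 4 ∨ 5 < ξ) :
    Inside N ξ η := by
  have hN' : (j : ℝ) + 1 ≤ N := by exact_mod_cast hj
  refine ⟨hξ, fun s k => ?_⟩
  have hk : (0 : ℝ) ≤ k := k.cast_nonneg
  have hkj : (k : ℝ) + 1 ≤ j ∨ (j : ℝ) ≤ k := by
    rcases lt_or_ge k j with h | h
    · left; exact_mod_cast h
    · right; exact_mod_cast h
  rintro ⟨⟨h1, h2⟩, h3, h4⟩
  obtain ⟨hη1, hη2⟩ := hη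
  fin_cases s <;> simp only [shape] at h1 h2 h3 h4
  · linarith
  · linarith
  · rcases hside with h | ⟨h, -⟩ <;> rcases hkj with h' | h' <;> linarith
  · rcases hside with h | ⟨-, h⟩ <;> rcases hkj with h' | h' <;> linarith
  · rcases hkj with h' | h' <;> linarith
  · rcases hmid with h | h | h <;> rcases hkj with h' | h' <;> linarith

namespace Layout

variable (G : Layout)

theorem InTube.of_le {G : Layout} {b : ℕ → Bool} {k n : ℕ} (hkn : k ≤ n) {z : Plane}
    (h : G.InTube b n z) : G.InTube b k z := by
  induction n, hkn using Nat.le_induction with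
  | base => exact h
  | succ n _ ih => exact ih h.of_succ

theorem base_sub_strictMono : StrictMono fun n => G.base n - G.v n :=
  strictMono_nat_of_lt_succ fun n => by linarith [G.base_le_base_succ_sub n, G.v_pos n]

theorem mem_free {b : ℕ → Bool} {n : ℕ} {z : Plane}
    (hi : Inside G.N (G.hc n (cell b n) (z 0)) (G.vc n (z 1)))
    (hz : z 1 < G.base (n + 1) - G.v (n + 1)) : z ∈ G.free := by
  have hT : G.InTube b n z := ⟨by linarith [hi.1.1], by linarith [hi.1.2]⟩
  refine G.mem_free_of_inside fun k => ?_
  rcases lt_trichotomy k n with hk | rfl | hk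
  · right
    refine ⟨cell b k, inside_of_rail _ _ ?_⟩
    obtain ⟨h1, h2⟩ := hT.of_le (Nat.succ_le_of_lt hk)
    rw [hc_succ] at h1 h2
    split_ifs at h1 h2
    · right; constructor <;> linarith
    · left; constructor <;> linarith
  · exact Or.inr ⟨_, hi⟩
  · left
    rw [vc_lt_iff]
    have := G.base_sub_strictMono.monotone (Nat.succ_le_of_lt hk)
    simp only [Nat.succ_eq_add_one] at this
    linarith

/-- The middle of the cell of level `n` selected by `b`. -/
noncomputable def mid (b : ℕ → Bool) (n : ℕ) : ℝ := G.len n * (cell b n + 1 / 2)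

theorem hc_eq_of (n : ℕ) (m : ℤ) (ξ : ℝ) : G.hc n m (G.len n * (m + ξ / 9)) = ξ := by
  have := (G.len_pos n).ne'
  simp only [hc]
  field_simp
  ring

theorem vc_eq_of (n : ℕ) (η : ℝ) : G.vc n (G.base n + G.v n * η) = η := by
  have := (G.v_pos n).ne'
  simp only [vc]
  field_simp
  ring

theorem mid_eq (b : ℕ → Bool) (n : ℕ) :
    G.mid b n = G.len n * (cell b n + (9 / 2 : ℝ) / 9) := by
  rw [mid]
  norm_num

theorem mid_succ (b : ℕ → Bool) (n : ℕ) :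
    G.mid b (n + 1) = G.len n * (cell b n + (if b n then (15 / 2 : ℝ) else 3 / 2) / 9) := by
  rw [mid, len_succ, cell]
  cases b n <;> · simp; ring

theorem mid_mem_free (b : ℕ → Bool) (n : ℕ) {y : ℝ} (hy : y < G.base n + G.v n) :
    (!₂[G.mid b n, y] : Plane) ∈ G.free := by
  refine G.mem_free (b := b) (n := n) (inside_of_lt_one G.one_le_N ?_ ?_ ?_) ?_
  · simp only [Matrix.cons_val_zero, mid_eq, hc_eq_of]
    norm_num
  · simp only [Matrix.cons_val_zero, mid_eq, hc_eq_of]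
    norm_num
  · simp only [Matrix.cons_val_one, Matrix.cons_val_zero]
    rw [vc_lt_iff]
    linarith
  · simp only [Matrix.cons_val_one, Matrix.cons_val_zero]
    linarith [G.base_add_le n, G.v_succ_le n, G.v_pos n]

/-- The point with given cell coordinates. -/
noncomputable def pt (n : ℕ) (m : ℤ) (ξ η : ℝ) : Plane :=
  !₂[G.len n * (m + ξ / 9), G.base n + G.v n * η]

theorem pt_mem_free {b : ℕ → Bool} {n : ℕ} {ξ η : ℝ} (hi : Inside G.N ξ η)
    (hη : η < 5 * G.N - 2) : G.pt n (cell b n) ξ η ∈ G.free := by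
  refine G.mem_free (b := b) (n := n) ?_ ?_
  · simpa only [pt, Matrix.cons_val_zero, Matrix.cons_val_one, hc_eq_of, vc_eq_of] using hi
  · simp only [pt, Matrix.cons_val_one, Matrix.cons_val_zero, base]
    have := mul_lt_mul_of_pos_left hη (G.v_pos n)
    linarith [G.v_succ_le n]

theorem geodesicDist_pt_horizontal {b : ℕ → Bool} {n : ℕ} {ξ ξ' η : ℝ} (hle : ξ ≤ ξ')
    (h : ∀ u ∈ Icc ξ ξ', G.pt n (cell b n) u η ∈ G.free) :
    geodesicDist G.free (G.pt n (cell b n) ξ' η) (G.pt n (cell b n) ξ η) ≤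
      ENNReal.ofReal (G.len n * ((ξ' - ξ) / 9)) := by
  have hl := G.len_pos n
  refine (geodesicDist_horizontal_le fun u hu => ?_).trans_eq ?_
  · rw [uIcc_of_ge (by gcongr)] at hu
    obtain ⟨h1, h2⟩ := hu
    have := h (G.hc n (cell b n) u) ⟨G.le_hc_iff.2 h1, G.hc_le_iff.2 h2⟩
    rw [pt] at this
    convert this using 3
    simp only [hc]
    field_simp
    ring
  · rw [abs_of_nonneg (by rw [sub_nonneg]; gcongr)]
    ring_nf

theorem geodesicDist_pt_vertical {b : ℕ → Bool} {n : ℕ} {ξ η η' : ℝ}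
    (h : ∀ u ∈ uIcc η η', G.pt n (cell b n) ξ u ∈ G.free) :
    geodesicDist G.free (G.pt n (cell b n) ξ η) (G.pt n (cell b n) ξ η') ≤
      ENNReal.ofReal (G.v n * |η - η'|) := by
  have hv := G.v_pos n
  have hmono : Monotone fun η => G.base n + G.v n * η := fun a b hab => by
    simp only
    gcongr
  refine (geodesicDist_vertical_le fun u hu => ?_).trans_eq ?_
  · have hu' : G.vc n u ∈ uIcc η η' := by
      rcases le_total η η' with hle | hle
      · rw [uIcc_of_le (hmono hle)] at hu
        rw [uIcc_of_le hle]
        exact ⟨G.le_vc_iff.2 hu.1, G.vc_le_iff.2 hu.2⟩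
      · rw [uIcc_of_ge (hmono hle)] at hu
        rw [uIcc_of_ge hle]
        exact ⟨G.le_vc_iff.2 hu.1, G.vc_le_iff.2 hu.2⟩
    have := h _ hu'
    rwa [pt, vc_mul, add_sub_cancel] at this
  · rw [add_sub_add_left_eq_sub, ← mul_sub, abs_mul, abs_of_pos hv]

theorem len_le (n : ℕ) : G.len n ≤ G.v n := by
  refine le_trans ?_ (G.e_le.trans (G.v_zero_le n))
  exact div_le_self G.e_pos.le (one_le_pow₀ (by norm_num))

theorem pt_rail_mem_free (b : ℕ → Bool) (n : ℕ) {η : ℝ} (hη : η < 5 * G.N) {ξ : ℝ}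
    (hξ : ξ = 3 / 2 ∨ ξ = 15 / 2) : G.pt n (cell b n) ξ η ∈ G.free := by
  have hy : G.base n + G.v n * η < G.base (n + 1) + G.v (n + 1) := by
    have := mul_lt_mul_of_pos_left hη (G.v_pos n)
    simp only [base]
    linarith [G.v_pos (n + 1)]
  set b' := Function.update b n (decide (ξ = 15 / 2)) with hb'
  have hc : cell b' n = cell b n := cell_congr fun j hj => Function.update_of_ne hj.ne _ _
  have := G.mid_mem_free b' (n + 1) hy
  rw [mid_succ, hc, hb', Function.update_self] at this
  have hif : (if decide (ξ = 15 / 2) = true then (15 / 2 : ℝ) else 3 / 2) = ξ := by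
    rcases hξ with rfl | rfl <;> norm_num
  rwa [hif] at this

/-- The two rails of a cell can be reached from each other, at any height, on a short path through
one of the storeys. -/
theorem geodesicDist_rails_le (b : ℕ → Bool) (n : ℕ) {η : ℝ} (h0 : 0 ≤ η) (hη : η < 5 * G.N) :
    geodesicDist G.free (G.pt n (cell b n) (15 / 2) η) (G.pt n (cell b n) (3 / 2) η) ≤
      ENNReal.ofReal (16 * G.v n) := by
  set j := ⌊η / 5⌋₊ with hj
  have hj1 : (j : ℝ) ≤ η / 5 := Nat.floor_le (by positivity)
  have hj2 : η / 5 < j + 1 := Nat.lt_floor_add_one _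
  have hjN : j < G.N := by exact_mod_cast (by linarith : (j : ℝ) < G.N)
  have hjN' : (j : ℝ) + 1 ≤ G.N := by exact_mod_cast hjN
  have hv := G.v_pos n
  have hl := G.len_le n
  have hl0 := G.len_pos n
  set P := G.pt n (cell b n) with hP
  have rail : ∀ ξ, ξ = 3 / 2 ∨ ξ = 15 / 2 →
      geodesicDist G.free (P ξ η) (P ξ (5 * j + 1 / 2)) ≤ ENNReal.ofReal (5 * G.v n) ∧
      geodesicDist G.free (P ξ (5 * j + 1 / 2)) (P ξ η) ≤ ENNReal.ofReal (5 * G.v n) := by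
    intro ξ hξ
    have hmem : ∀ u ∈ uIcc η (5 * j + 1 / 2), P ξ u ∈ G.free := by
      intro u hu
      have : u ≤ max η (5 * j + 1 / 2) := hu.2
      exact G.pt_rail_mem_free b n (this.trans_lt (max_lt hη (by linarith))) hξ
    have hab : |η - (5 * j + 1 / 2)| ≤ 5 := by
      rw [abs_le]
      constructor <;> linarith
    constructor
    · refine (G.geodesicDist_pt_vertical hmem).trans (ENNReal.ofReal_le_ofReal ?_)
      rw [mul_comm]
      gcongr
    · refine (G.geodesicDist_pt_vertical (by rwa [uIcc_comm])).trans (ENNReal.ofReal_le_ofReal ?_)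
      rw [mul_comm, abs_sub_comm]
      gcongr
  have vert : ∀ ξ, ξ = 7 / 2 ∨ ξ = 11 / 2 → ∀ u ∈ Icc (5 * j + 1 / 2 : ℝ) (5 * j + 5 / 2),
      P ξ u ∈ G.free := by
    intro ξ hξ u hu
    refine G.pt_mem_free (inside_of_storey hjN ?_ hu ?_ ?_) (by linarith [hu.2])
    · rcases hξ with rfl | rfl <;> norm_num
    · right
      rcases hξ with rfl | rfl <;> norm_num
    · right
      rcases hξ with rfl | rfl <;> norm_num
  have up : ∀ ξ, ξ = 7 / 2 ∨ ξ = 11 / 2 → ∀ u w, u ∈ Icc (5 * j + 1 / 2 : ℝ) (5 * j + 5 / 2) →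
      w ∈ Icc (5 * j + 1 / 2 : ℝ) (5 * j + 5 / 2) →
      geodesicDist G.free (P ξ u) (P ξ w) ≤ ENNReal.ofReal (2 * G.v n) := by
    intro ξ hξ u w hu hw
    refine (G.geodesicDist_pt_vertical fun t ht => vert ξ hξ t (uIcc_subset_Icc hu hw ht)).trans
      (ENNReal.ofReal_le_ofReal ?_)
    rw [mul_comm]
    refine mul_le_mul_of_nonneg_right ?_ hv.le
    rw [abs_le]
    constructor <;> linarith [hu.1, hu.2, hw.1, hw.2]
  have door : ∀ ξ, 1 < ξ → ξ + 2 < 8 → ξ + 2 < 4 ∨ 5 < ξ →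
      geodesicDist G.free (P (ξ + 2) (5 * j + 1 / 2)) (P ξ (5 * j + 1 / 2)) ≤
        ENNReal.ofReal (G.v n / 3) := by
    intro ξ h1 h2 h3
    refine (G.geodesicDist_pt_horizontal (by linarith) fun u hu => ?_).trans
      (ENNReal.ofReal_le_ofReal (by linarith))
    refine G.pt_mem_free (inside_of_storey hjN ⟨by linarith [hu.1], by linarith [hu.2]⟩
      ⟨le_rfl, by linarith⟩ (Or.inl (by linarith)) (Or.inr ?_)) (by linarith)
    exact h3.imp (fun h => by linarith [hu.2]) (fun h => by linarith [hu.1])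
  have top : geodesicDist G.free (P (7 / 2 + 2) (5 * j + 5 / 2)) (P (7 / 2) (5 * j + 5 / 2)) ≤
      ENNReal.ofReal (G.v n / 3) := by
    refine (G.geodesicDist_pt_horizontal (by linarith) fun u hu => ?_).trans
      (ENNReal.ofReal_le_ofReal (by linarith))
    exact G.pt_mem_free (inside_of_storey hjN ⟨by linarith [hu.1], by linarith [hu.2]⟩
      ⟨by linarith, le_rfl⟩ (Or.inr ⟨by linarith [hu.1], by linarith [hu.2]⟩)
      (Or.inl (by linarith))) (by linarith)
  have e1 : (11 / 2 + 2 : ℝ) = 15 / 2 := by norm_num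
  have e2 : (7 / 2 + 2 : ℝ) = 11 / 2 := by norm_num
  have e3 : (3 / 2 + 2 : ℝ) = 7 / 2 := by norm_num
  have d1 := door (11 / 2) (by norm_num) (by norm_num) (Or.inr (by norm_num))
  have d2 := door (3 / 2) (by norm_num) (by norm_num) (Or.inl (by norm_num))
  rw [e1] at d1
  rw [e3] at d2
  rw [e2] at top
  have lo : (5 * j + 1 / 2 : ℝ) ∈ Icc (5 * j + 1 / 2 : ℝ) (5 * j + 5 / 2) :=
    ⟨le_rfl, by linarith⟩
  have hi : (5 * j + 5 / 2 : ℝ) ∈ Icc (5 * j + 1 / 2 : ℝ) (5 * j + 5 / 2) :=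
    ⟨by linarith, le_rfl⟩
  have h1 := (geodesicDist_triangle G.free _ _ _).trans
    (add_le_add (rail (15 / 2) (Or.inr rfl)).1 d1)
  have h2 := (geodesicDist_triangle G.free _ _ _).trans
    (add_le_add h1 (up (11 / 2) (Or.inr rfl) _ _ lo hi))
  have h3 := (geodesicDist_triangle G.free _ _ _).trans (add_le_add h2 top)
  have h4 := (geodesicDist_triangle G.free _ _ _).trans
    (add_le_add h3 (up (7 / 2) (Or.inl rfl) _ _ hi lo))
  have h5 := (geodesicDist_triangle G.free _ _ _).trans (add_le_add h4 d2)
  have h6 := (geodesicDist_triangle G.free _ _ _).trans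
    (add_le_add h5 (rail (3 / 2) (Or.inl rfl)).2)
  refine h6.trans ?_
  repeat rw [← ENNReal.ofReal_add (by positivity) (by positivity)]
  exact ENNReal.ofReal_le_ofReal (by linarith)

/-! ### The trajectories of the target -/

/-- The first coordinate, at height `y`, of a target that makes its first `n` choices according
to `b`. It moves from the middle of one cell to the middle of the next one while the height
increases by one unit, at the fork. -/
noncomputable def track (b : ℕ → Bool) : ℕ → ℝ → ℝ
  | 0, _ => G.mid b 0
  | n + 1, y => track b n y + (G.mid b (n + 1) - G.mid b n) * max 0 (min 1 (G.vc n y))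

/-- The first coordinate of the target at height `y`: the number of choices taken into account
is large enough for the next fork to be higher than `y`. -/
noncomputable def xpos (b : ℕ → Bool) (y : ℝ) : ℝ := G.track b ⌈y / G.v 0⌉₊ y

theorem track_of_le {b : ℕ → Bool} {n m : ℕ} (hnm : n ≤ m) {y : ℝ} (hy : y ≤ G.base n) :
    G.track b m y = G.track b n y := by
  induction m, hnm using Nat.le_induction with
  | base => rfl
  | succ m hm ih =>
    have h0 : G.vc m y ≤ 0 := by
      rw [vc_le_iff]
      linarith [G.base_mono hm]
    rw [track, ih, max_eq_left ((min_le_right _ _).trans h0)]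
    ring

theorem xpos_eq_track {b : ℕ → Bool} {n : ℕ} {y : ℝ} (hy : y ≤ G.base n) :
    G.xpos b y = G.track b n y := by
  have hK : y ≤ G.base ⌈y / G.v 0⌉₊ := by
    refine le_trans ?_ (G.mul_v_zero_le_base _)
    rw [← div_le_iff₀ G.v_zero_pos]
    exact Nat.le_ceil _
  rcases le_total n ⌈y / G.v 0⌉₊ with h | h
  · exact G.track_of_le h hy
  · exact (G.track_of_le h hK).symm

theorem track_of_ge {b : ℕ → Bool} {n : ℕ} {y : ℝ} (hy : G.base n ≤ y) :
    G.track b n y = G.mid b n := by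
  induction n with
  | zero => rfl
  | succ n ih =>
    have h1 : 1 ≤ G.vc n y := by
      rw [le_vc_iff]
      linarith [G.base_add_le n, G.v_pos n]
    rw [track, ih ((G.base_mono n.le_succ).trans hy), min_eq_left h1, max_eq_right zero_le_one]
    ring

theorem xpos_eq {b : ℕ → Bool} {n : ℕ} {y : ℝ} (h : G.base n ≤ y) (h' : y ≤ G.base (n + 1)) :
    G.xpos b y = G.mid b n + (G.mid b (n + 1) - G.mid b n) * max 0 (min 1 (G.vc n y)) := by
  rw [G.xpos_eq_track h', track, G.track_of_ge h]

theorem mid_congr {b b' : ℕ → Bool} {n : ℕ} (h : ∀ j < n, b j = b' j) :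
    G.mid b n = G.mid b' n := by
  rw [mid, mid, cell_congr h]

theorem track_congr {b b' : ℕ → Bool} {n : ℕ} (h : ∀ j < n, b j = b' j) (y : ℝ) :
    G.track b n y = G.track b' n y := by
  induction n with
  | zero => exact G.mid_congr h
  | succ n ih =>
    have h' : ∀ j < n, b j = b' j := fun j hj => h j (by omega)
    rw [track, track, ih h', G.mid_congr h, G.mid_congr h']

theorem mid_succ_sub (b : ℕ → Bool) (n : ℕ) :
    G.mid b (n + 1) - G.mid b n = G.len n * ((if b n then 1 else -1) / 3) := by
  rw [mid_succ, mid]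
  split_ifs <;> ring

theorem abs_mid_succ_sub (b : ℕ → Bool) (n : ℕ) :
    |G.mid b (n + 1) - G.mid b n| = G.len n / 3 := by
  rw [mid_succ_sub, abs_mul, abs_of_pos (G.len_pos n)]
  split_ifs
  · rw [abs_of_pos (by norm_num)]; ring
  · rw [abs_of_neg (by norm_num)]; ring

theorem abs_track_sub_le (b : ℕ → Bool) (n : ℕ) (y y' : ℝ) :
    |G.track b n y - G.track b n y'| ≤ G.e / G.v 0 * (1 - (1 / 9) ^ n) * |y - y'| := by
  induction n with
  | zero => simp [track]
  | succ n ih =>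
    have hv := G.v_pos n
    have hclamp : |max 0 (min 1 (G.vc n y)) - max 0 (min 1 (G.vc n y'))| ≤ |y - y'| / G.v 0 := by
      have h1 := abs_max_sub_max_le_max 0 (min 1 (G.vc n y)) 0 (min 1 (G.vc n y'))
      have h2 := abs_min_sub_min_le_max 1 (G.vc n y) 1 (G.vc n y')
      rw [sub_self, abs_zero] at h1 h2
      refine (h1.trans (max_le (abs_nonneg _)
        (h2.trans (max_le (abs_nonneg _) le_rfl)))).trans ?_
      rw [vc, vc, ← sub_div, sub_sub_sub_cancel_right, abs_div, abs_of_pos hv]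
      exact div_le_div_of_nonneg_left (abs_nonneg _) G.v_zero_pos (G.v_zero_le n)
    have hstep : |(G.mid b (n + 1) - G.mid b n) *
        (max 0 (min 1 (G.vc n y)) - max 0 (min 1 (G.vc n y')))| ≤
        G.len n / 3 * (|y - y'| / G.v 0) := by
      rw [abs_mul, abs_mid_succ_sub]
      exact mul_le_mul_of_nonneg_left hclamp (by linarith [G.len_pos n])
    have hlen : G.len n = G.e * (1 / 9) ^ n := by
      rw [len, one_div, inv_pow, div_eq_mul_inv]
    have e : G.track b (n + 1) y - G.track b (n + 1) y' =
        (G.track b n y - G.track b n y') + (G.mid b (n + 1) - G.mid b n) *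
        (max 0 (min 1 (G.vc n y)) - max 0 (min 1 (G.vc n y'))) := by
      simp only [track]
      ring
    rw [e]
    refine (abs_add_le _ _).trans ((add_le_add ih hstep).trans ?_)
    have hX : 0 ≤ G.e / G.v 0 * (1 / 9) ^ n * |y - y'| := by
      have := G.e_pos
      have := G.v_zero_pos
      positivity
    rw [hlen, pow_succ]
    have e1 : G.e * (1 / 9) ^ n / 3 * (|y - y'| / G.v 0) =
        (G.e / G.v 0 * (1 / 9) ^ n * |y - y'|) / 3 := by ring
    rw [e1]
    linarith

theorem abs_xpos_sub_le (b : ℕ → Bool) (y y' : ℝ) :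
    |G.xpos b y - G.xpos b y'| ≤ G.e / G.v 0 * |y - y'| := by
  obtain ⟨n, hn⟩ := exists_nat_ge (max y y' / G.v 0)
  rw [div_le_iff₀ G.v_zero_pos] at hn
  have hn' := hn.trans (G.mul_v_zero_le_base n)
  rw [G.xpos_eq_track ((le_max_left _ _).trans hn'), G.xpos_eq_track ((le_max_right _ _).trans hn')]
  refine (G.abs_track_sub_le b n y y').trans (mul_le_mul_of_nonneg_right ?_ (abs_nonneg _))
  have := G.e_pos
  have := G.v_zero_pos
  have h9 : (0 : ℝ) ≤ (1 / 9) ^ n := by positivity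
  exact mul_le_of_le_one_right (by positivity) (by linarith)

/-- At the fork, the target is between the two rails. -/
theorem hc_xpos_mem {b : ℕ → Bool} {n : ℕ} {y : ℝ} (h : G.base n ≤ y) (h' : y ≤ G.base (n + 1)) :
    G.hc n (cell b n) (G.xpos b y) ∈ Icc (3 / 2) (15 / 2) := by
  have e : G.xpos b y = G.len n * (cell b n +
      (9 / 2 + 3 * (if b n then 1 else -1) * max 0 (min 1 (G.vc n y))) / 9) := by
    rw [G.xpos_eq h h', mid_succ_sub, mid]
    ring
  have h0 : 0 ≤ max 0 (min 1 (G.vc n y)) := le_max_left _ _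
  have h1 : max 0 (min 1 (G.vc n y)) ≤ 1 := max_le zero_le_one (min_le_left _ _)
  rw [e, hc_eq_of]
  split_ifs <;> constructor <;> linarith

theorem xpos_of_one_le {b : ℕ → Bool} {n : ℕ} {y : ℝ} (h1 : 1 ≤ G.vc n y)
    (h' : y ≤ G.base (n + 1)) : G.xpos b y = G.mid b (n + 1) := by
  have h : G.base n ≤ y := by
    rw [le_vc_iff] at h1
    linarith [G.v_pos n]
  rw [G.xpos_eq h h', min_eq_left h1, max_eq_right zero_le_one]
  ring

theorem exists_level {y : ℝ} (hy : 0 ≤ y) : ∃ n, G.base n ≤ y ∧ y < G.base (n + 1) := by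
  obtain ⟨m, hm⟩ := exists_nat_gt (y / G.v 0)
  rw [div_lt_iff₀ G.v_zero_pos] at hm
  have hex : ∃ m, y < G.base m := ⟨m, hm.trans_le (G.mul_v_zero_le_base m)⟩
  classical
  obtain ⟨n, hn⟩ : ∃ n, Nat.find hex = n + 1 := by
    refine Nat.exists_eq_succ_of_ne_zero fun h0 => ?_
    have := Nat.find_spec hex
    rw [h0] at this
    simp only [base] at this
    linarith
  refine ⟨n, not_lt.1 (Nat.find_min hex (by omega)), ?_⟩
  rw [← hn]
  exact Nat.find_spec hex

theorem fork_mem_free {b : ℕ → Bool} {n : ℕ} {x y : ℝ}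
    (hx : G.hc n (cell b n) x ∈ Icc (3 / 2) (15 / 2)) (hy : G.vc n y < 1) :
    (!₂[x, y] : Plane) ∈ G.free := by
  refine G.mem_free (b := b) (n := n) (inside_of_lt_one G.one_le_N ?_ ?_ ?_) ?_
  · simp only [Matrix.cons_val_zero]
    linarith [hx.1]
  · simp only [Matrix.cons_val_zero]
    linarith [hx.2]
  · simpa only [Matrix.cons_val_one, Matrix.cons_val_zero] using hy
  · simp only [Matrix.cons_val_one, Matrix.cons_val_zero]
    rw [vc_lt_iff] at hy
    linarith [G.base_add_le n, G.v_succ_le n, G.v_pos n]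

theorem xpos_mem_free (b : ℕ → Bool) {y : ℝ} (hy : 0 ≤ y) :
    (!₂[G.xpos b y, y] : Plane) ∈ G.free := by
  obtain ⟨n, h, h'⟩ := G.exists_level hy
  rcases lt_or_ge (G.vc n y) 1 with h1 | h1
  · exact G.fork_mem_free (G.hc_xpos_mem h h'.le) h1
  · rw [G.xpos_of_one_le h1 h'.le]
    exact G.mid_mem_free b (n + 1) (by linarith [G.v_pos (n + 1)])

theorem inTube_xpos {b : ℕ → Bool} {n : ℕ} {y : ℝ} (h : G.base n ≤ y) :
    G.InTube b n !₂[G.xpos b y, y] := by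
  obtain ⟨m, hm, hm'⟩ := G.exists_level ((G.base_nonneg n).trans h)
  have hnm : n ≤ m := by
    by_contra! hlt
    linarith [G.base_mono (Nat.succ_le_of_lt hlt)]
  refine InTube.of_le hnm ?_
  have := G.hc_xpos_mem (b := b) hm hm'.le
  simp only [InTube, Matrix.cons_val_zero]
  constructor <;> linarith [this.1, this.2]

/-- Two targets that differ only in the choice of the present phase are close to each other. -/
theorem geodesicDist_xpos_le {b b' : ℕ → Bool} {n : ℕ} (hb : ∀ j < n, b j = b' j)
    (ht : b n = true) (hf : b' n = false) {y : ℝ} (h : G.base n ≤ y) (h' : y < G.base (n + 1)) :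
    geodesicDist G.free !₂[G.xpos b y, y] !₂[G.xpos b' y, y] ≤ ENNReal.ofReal (16 * G.v n) := by
  have hv := G.v_pos n
  have hc := cell_congr hb
  rcases lt_or_ge (G.vc n y) 1 with h1 | h1
  · have m := G.hc_xpos_mem (b := b) h h'.le
    have m' := G.hc_xpos_mem (b := b') h h'.le
    rw [← hc] at m'
    have hmono : Monotone fun x => G.hc n (cell b n) x := by
      have := G.len_pos n
      intro x x' hx
      simp only [Layout.hc]
      gcongr
    refine (geodesicDist_horizontal_le fun u hu => G.fork_mem_free (b := b) ?_ h1).trans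
      (ENNReal.ofReal_le_ofReal ?_)
    · exact uIcc_subset_Icc m m' (hmono.mapsTo_uIcc hu)
    · rw [mem_Icc, le_hc_iff, hc_le_iff] at m m'
      have hl := G.len_le n
      have hl0 := G.len_pos n
      rw [abs_le]
      constructor <;> linarith [m.1, m.2, m'.1, m'.2]
  · have h0 : 0 ≤ G.vc n y := by linarith
    have hN : G.vc n y < 5 * G.N := by
      rw [vc_lt_iff]
      simp only [base] at h'
      linarith
    have key := G.geodesicDist_rails_le b n h0 hN
    have ey : G.base n + G.v n * G.vc n y = y := by rw [vc_mul]; ring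
    rw [pt, pt, ey] at key
    rw [G.xpos_of_one_le h1 h'.le, G.xpos_of_one_le h1 h'.le, mid_succ, mid_succ, ht, hf, ← hc]
    simpa using key

end Layout

/-! ### The choice of the measurements -/

/-- The times at which the phases begin. The phase that begins at time `s` lasts as long as the
statement allows if the distance at its beginning is `d₀ + s / (200 * lam)`. -/
noncomputable def phaseTime (lam d₀ : ℝ) : ℕ → ℝ
  | 0 => 0
  | n + 1 => phaseTime lam d₀ n + (1 + 1 / lam) * (d₀ + 1 / 200 * phaseTime lam d₀ n / lam)

/-- The distance between the tracker and the target that is to be attained after `n` phases. -/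
noncomputable def gap (lam d₀ : ℝ) (n : ℕ) : ℝ := d₀ + 1 / 200 * phaseTime lam d₀ n / lam

/-- The speed at which the target gains height. It is slightly smaller than `1`, which leaves room
for the movements in the other direction. -/
noncomputable def climb (lam : ℝ) : ℝ := 1 - 1 / 200 / lam

/-- The number of storeys of each level. There are so many of them that the way from one rail to the
other, of length at most `16` units, is within the error bound, and so few that the loss of `2`
units by a wrong guess exceeds the required gain. -/
noncomputable def storeys (lam : ℝ) : ℕ := ⌈16 * lam⌉₊

/-- The vertical unit of level `n`: the target climbs a level in one phase. -/
noncomputable def unitHeight (lam d₀ : ℝ) (n : ℕ) : ℝ :=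
  climb lam * (1 + 1 / lam) * gap lam d₀ n / (5 * storeys lam)

section Estimates

variable {lam d₀ : ℝ}

theorem phaseTime_succ (lam d₀ : ℝ) (n : ℕ) :
    phaseTime lam d₀ (n + 1) = phaseTime lam d₀ n + (1 + 1 / lam) * gap lam d₀ n := rfl

theorem phaseTime_nonneg (hl : 1 ≤ lam) (hd : 0 < d₀) (n : ℕ) : 0 ≤ phaseTime lam d₀ n := by
  induction n with
  | zero => exact le_rfl
  | succ n ih =>
    rw [phaseTime]
    positivity

theorem le_gap (hl : 1 ≤ lam) (hd : 0 < d₀) (n : ℕ) : d₀ ≤ gap lam d₀ n := by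
  have := phaseTime_nonneg hl hd n
  have : 0 ≤ 1 / 200 * phaseTime lam d₀ n / lam := by positivity
  rw [gap]
  linarith

theorem gap_pos (hl : 1 ≤ lam) (hd : 0 < d₀) (n : ℕ) : 0 < gap lam d₀ n :=
  hd.trans_le (le_gap hl hd n)

theorem gap_succ (lam d₀ : ℝ) (n : ℕ) : gap lam d₀ (n + 1) =
    gap lam d₀ n + 1 / 200 * ((1 + 1 / lam) * gap lam d₀ n) / lam := by
  have h : gap lam d₀ n = d₀ + 1 / 200 * phaseTime lam d₀ n / lam := rfl
  rw [gap, phaseTime_succ]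
  linear_combination -h

theorem one_div_lam_mem (hl : 1 ≤ lam) : 0 < 1 / lam ∧ 1 / lam ≤ 1 :=
  ⟨by positivity, by rw [div_le_one (by positivity)]; exact hl⟩

theorem climb_eq (lam : ℝ) : climb lam = 1 - 1 / lam / 200 := by
  rw [climb]
  ring

theorem climb_pos (hl : 1 ≤ lam) : 0 < climb lam := by
  rw [climb_eq]
  linarith [(one_div_lam_mem hl).2]

theorem storeys_bounds (hl : 1 ≤ lam) :
    16 * lam ≤ storeys lam ∧ (storeys lam : ℝ) ≤ 17 * lam := by
  have h1 := Nat.le_ceil (16 * lam)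
  have h2 := Nat.ceil_lt_add_one (by positivity : 0 ≤ 16 * lam)
  exact ⟨h1, by rw [storeys]; linarith⟩

theorem storeys_pos (hl : 1 ≤ lam) : (0 : ℝ) < storeys lam := by
  linarith [(storeys_bounds hl).1]

theorem storeys_mul_unit (hl : 1 ≤ lam) (d₀ : ℝ) (n : ℕ) :
    5 * storeys lam * unitHeight lam d₀ n = climb lam * ((1 + 1 / lam) * gap lam d₀ n) := by
  have := (storeys_pos hl).ne'
  rw [unitHeight]
  field_simp

theorem unit_pos (hl : 1 ≤ lam) (hd : 0 < d₀) (n : ℕ) : 0 < unitHeight lam d₀ n := by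
  have := climb_pos hl
  have := gap_pos hl hd n
  have := storeys_pos hl
  rw [unitHeight]
  positivity

theorem unit_le (hl : 1 ≤ lam) (hd : 0 < d₀) (n : ℕ) :
    40 * unitHeight lam d₀ n ≤ gap lam d₀ n * (1 / lam) := by
  have hg := gap_pos hl hd n
  have hc := climb_pos hl
  obtain ⟨i0, i1⟩ := one_div_lam_mem hl
  have h1 := storeys_mul_unit hl d₀ n
  have h2 : climb lam * ((1 + 1 / lam) * gap lam d₀ n) ≤ 1 * (2 * gap lam d₀ n) := by
    have : climb lam ≤ 1 := by rw [climb_eq]; linarith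
    gcongr
    linarith
  have h3 : 80 * lam * unitHeight lam d₀ n ≤ 5 * storeys lam * unitHeight lam d₀ n :=
    mul_le_mul_of_nonneg_right (by linarith [(storeys_bounds hl).1]) (unit_pos hl hd n).le
  rw [mul_one_div, le_div_iff₀ (by positivity)]
  linarith

/-- What the target loses by climbing at a speed smaller than `1`, together with the required gain,
is no more than what the tracker loses by a wrong guess. -/
theorem loss_le (hl : 1 ≤ lam) (hd : 0 < d₀) (n : ℕ) :
    1 / 100 * ((1 + 1 / lam) * gap lam d₀ n) / lam ≤ 2 * unitHeight lam d₀ n := by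
  have hg := gap_pos hl hd n
  obtain ⟨i0, i1⟩ := one_div_lam_mem hl
  set τ := (1 + 1 / lam) * gap lam d₀ n with hτ
  have hτ0 : 0 < τ := by positivity
  have h1 := storeys_mul_unit hl d₀ n
  have h2 : (199 / 200 : ℝ) * τ ≤ climb lam * τ :=
    mul_le_mul_of_nonneg_right (by rw [climb_eq]; linarith) hτ0.le
  have h3 : 5 * storeys lam * unitHeight lam d₀ n ≤ 85 * lam * unitHeight lam d₀ n :=
    mul_le_mul_of_nonneg_right (by linarith [(storeys_bounds hl).2]) (unit_pos hl hd n).le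
  rw [div_le_iff₀ (by positivity)]
  linarith

/-- A tracker that is not past the fork at the end of a phase is far enough behind. -/
theorem fork_far (hl : 1 ≤ lam) (hd : 0 < d₀) (n : ℕ) :
    2 * unitHeight lam d₀ n ≤ climb lam * ((1 + 1 / lam) * gap lam d₀ n) - gap lam d₀ (n + 1) := by
  have hg := gap_pos hl hd n
  have hu := unit_le hl hd n
  obtain ⟨i0, i1⟩ := one_div_lam_mem hl
  rw [gap_succ, climb_eq]
  set i := 1 / lam with hi
  have e : 1 / 200 * ((1 + i) * gap lam d₀ n) / lam = 1 / 200 * ((1 + i) * gap lam d₀ n) * i := by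
    rw [hi]
    ring
  rw [e]
  have h2 : gap lam d₀ n * i * i ≤ gap lam d₀ n * i := mul_le_of_le_one_right (by positivity) i1
  have h3 : 0 < gap lam d₀ n * i := by positivity
  nlinarith

theorem unit_succ_le (hl : 1 ≤ lam) (hd : 0 < d₀) (n : ℕ) :
    unitHeight lam d₀ (n + 1) ≤ 2 * unitHeight lam d₀ n := by
  have hg := gap_pos hl hd n
  have hc := climb_pos hl
  have hs := storeys_pos hl
  obtain ⟨i0, i1⟩ := one_div_lam_mem hl
  have h : gap lam d₀ (n + 1) ≤ 2 * gap lam d₀ n := by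
    have h1 := loss_le hl hd n
    have h2 := unit_le hl hd n
    have h3 : gap lam d₀ n * (1 / lam) ≤ gap lam d₀ n := mul_le_of_le_one_right hg.le i1
    rw [gap_succ]
    have e : 1 / 100 * ((1 + 1 / lam) * gap lam d₀ n) / lam =
      2 * (1 / 200 * ((1 + 1 / lam) * gap lam d₀ n) / lam) := by ring
    linarith
  rw [unitHeight, unitHeight, ← mul_div_assoc, mul_left_comm]
  gcongr

theorem unit_zero_le (hl : 1 ≤ lam) (hd : 0 < d₀) (n : ℕ) :
    unitHeight lam d₀ 0 ≤ unitHeight lam d₀ n := by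
  have hc := climb_pos hl
  have hs := storeys_pos hl
  have h : gap lam d₀ 0 ≤ gap lam d₀ n := by
    simpa [gap, phaseTime] using le_gap hl hd n
  rw [unitHeight, unitHeight]
  gcongr

theorem phaseTime_strictMono (hl : 1 ≤ lam) (hd : 0 < d₀) : StrictMono (phaseTime lam d₀) :=
  strictMono_nat_of_lt_succ fun n => by
    have := gap_pos hl hd n
    rw [phaseTime_succ]
    exact lt_add_of_pos_right _ (by positivity)

theorem mul_le_phaseTime (hl : 1 ≤ lam) (hd : 0 < d₀) (n : ℕ) : n * d₀ ≤ phaseTime lam d₀ n := by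
  induction n with
  | zero => simp [phaseTime]
  | succ n ih =>
    have hg := le_gap hl hd n
    have h : 0 ≤ 1 / lam * gap lam d₀ n := by
      have := gap_pos hl hd n
      positivity
    rw [phaseTime_succ]
    push_cast
    linarith

/-- The environment for given values of the localization precision and the initial distance. -/
noncomputable def layout (hl : 1 ≤ lam) (hd : 0 < d₀) : Layout where
  e := 1 / 200 / lam * unitHeight lam d₀ 0
  N := storeys lam
  v := unitHeight lam d₀
  e_pos := by
    have := unit_pos hl hd 0
    positivity
  one_le_N := Nat.one_le_iff_ne_zero.2 (by exact_mod_cast (storeys_pos hl).ne')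
  v_zero_pos := unit_pos hl hd 0
  v_zero_le := unit_zero_le hl hd
  v_succ_le := unit_succ_le hl hd
  e_le := by
    have := one_div_lam_mem hl
    refine mul_le_of_le_one_left (unit_pos hl hd 0).le ?_
    rw [div_right_comm]
    linarith

/-- The target reaches level `n` at the beginning of phase `n`. -/
theorem base_layout (hl : 1 ≤ lam) (hd : 0 < d₀) (n : ℕ) :
    (layout hl hd).base n = climb lam * phaseTime lam d₀ n := by
  induction n with
  | zero => simp [Layout.base, phaseTime]
  | succ n ih =>
    have := storeys_mul_unit hl d₀ n
    rw [Layout.base, ih, phaseTime_succ, mul_add, ← this]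
    rfl

end Estimates

/-! ### The strategy of the target -/

section Strategy

variable {lam d₀ : ℝ} (hl : 1 ≤ lam) (hd : 0 < d₀)

/-- The position of the target at time `t`. -/
noncomputable def targetAt (b : ℕ → Bool) (t : ℝ≥0) : Plane :=
  !₂[(layout hl hd).xpos b (climb lam * t), climb lam * t]

/-- The choices that may be revealed at time `t`; the others are replaced by `false`. -/
noncomputable def revealed (lam d₀ : ℝ) (b : ℕ → Bool) (t : ℝ≥0) (j : ℕ) : Bool :=
  if (t : ℝ) < phaseTime lam d₀ (j + 1) then false else b j

theorem targetAt_congr {b b' : ℕ → Bool} {i : ℕ} (h : ∀ j ≤ i, b j = b' j) {t : ℝ≥0}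
    (ht : (t : ℝ) ≤ phaseTime lam d₀ (i + 1)) : targetAt hl hd b t = targetAt hl hd b' t := by
  have hy : climb lam * t ≤ (layout hl hd).base (i + 1) := by
    rw [base_layout]
    exact mul_le_mul_of_nonneg_left ht (climb_pos hl).le
  rw [targetAt, targetAt, Layout.xpos_eq_track _ hy, Layout.xpos_eq_track _ hy,
    Layout.track_congr _ fun j hj => h j (by omega)]

theorem revealed_eq {b b' : ℕ → Bool} {i : ℕ} (h : ∀ j < i, b j = b' j) {t : ℝ≥0}
    (ht : (t : ℝ) < phaseTime lam d₀ (i + 1)) {j : ℕ} (hj : j ≤ i) :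
    revealed lam d₀ b t j = revealed lam d₀ b' t j := by
  unfold revealed
  split_ifs with h1
  · rfl
  · refine h j (lt_of_le_of_ne hj ?_)
    rintro rfl
    exact h1 ht

theorem dist_plane_le (x y x' y' : ℝ) :
    dist (!₂[x, y] : Plane) !₂[x', y'] ≤ |x - x'| + |y - y'| := by
  rw [EuclideanSpace.dist_eq, Real.sqrt_le_left (by positivity)]
  simp only [Fin.sum_univ_two, Real.dist_eq, Matrix.cons_val_zero, Matrix.cons_val_one]
  nlinarith [abs_nonneg (x - x'), abs_nonneg (y - y')]

theorem isMotion_targetAt (b : ℕ → Bool) : IsMotion (layout hl hd).free (targetAt hl hd b) := by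
  have hc := climb_pos hl
  refine ⟨fun t => Layout.xpos_mem_free _ b (by positivity), fun s t => ?_⟩
  have h1 := (layout hl hd).abs_xpos_sub_le b (climb lam * s) (climb lam * t)
  have he : (layout hl hd).e / (layout hl hd).v 0 = 1 / 200 / lam :=
    mul_div_cancel_right₀ _ (unit_pos hl hd 0).ne'
  rw [he, ← mul_sub, abs_mul, abs_of_pos hc] at h1
  refine (dist_plane_le _ _ _ _).trans ?_
  rw [← mul_sub, abs_mul, abs_of_pos hc, NNReal.dist_eq]
  have h2 : climb lam * |(s : ℝ) - t| ≤ |(s : ℝ) - t| := by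
    refine mul_le_of_le_one_left (abs_nonneg _) ?_
    rw [climb_eq]
    linarith [(one_div_lam_mem hl).1]
  have h3 : 0 ≤ 1 / 200 / lam := by positivity
  have h4 := mul_le_mul_of_nonneg_left h2 h3
  have e : climb lam * |(s : ℝ) - t| = |(s : ℝ) - t| - 1 / 200 / lam * |(s : ℝ) - t| := by
    rw [climb]
    ring
  linarith

/-- The strategy of the target: climb, and report the trajectory in which the choice of the present
phase is `false`. -/
noncomputable def strategy : PhaseStrategy (layout hl hd).free
    !₂[(layout hl hd).mid (fun _ => false) 0, 0] where
  time n := ⟨phaseTime lam d₀ n, phaseTime_nonneg hl hd n⟩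
  time_zero := rfl
  time_strictMono _ _ h := phaseTime_strictMono hl hd h
  time_tendsto := by
    refine NNReal.tendsto_coe_atTop.1 ?_
    exact tendsto_atTop_mono (mul_le_phaseTime hl hd)
      (tendsto_natCast_atTop_atTop.atTop_mul_const hd)
  target := targetAt hl hd
  report b t := targetAt hl hd (revealed lam d₀ b t) t
  start b := by
    have h : (layout hl hd).xpos b 0 = (layout hl hd).mid (fun _ => false) 0 :=
      Layout.xpos_eq_track (n := 0) _ le_rfl
    rw [targetAt, NNReal.coe_zero, mul_zero, h]
  motion := isMotion_targetAt hl hd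
  target_causal _ _ _ h _ ht := targetAt_congr hl hd h ht
  report_causal _ _ _ h _ ht :=
    targetAt_congr hl hd (fun _ hj => revealed_eq h ht hj) (le_of_lt ht)

/-- Up to the end of a phase, the position of the tracker does not depend on the choice made by the
target in that phase. -/
theorem PhaseStrategy.path_congr {F : Set Plane} {p₀ q₀ : Plane} (S : PhaseStrategy F q₀)
    (T : TrackerStrategy F p₀) {b b' : ℕ → Bool} {i : ℕ} (h : ∀ j < i, b j = b' j) {t : ℝ≥0}
    (ht : t ≤ S.time (i + 1)) : T.path (S.report b) t = T.path (S.report b') t := by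
  have hlt : ∀ t < S.time (i + 1), T.path (S.report b) t = T.path (S.report b') t := fun t ht =>
    T.causal _ _ t fun s hs => S.report_causal b b' i h s (hs.trans_lt ht)
  have hcont : ∀ a, Continuous (T.path a) := fun a =>
    (LipschitzWith.of_dist_le_mul (K := 1) fun s t => by
      simpa using (T.motion a).2 s t).continuous
  have hcl : IsClosed {t | T.path (S.report b) t = T.path (S.report b') t} :=
    isClosed_eq (hcont _) (hcont _)
  have h0 : S.time (i + 1) ≠ 0 := by
    rw [← S.time_zero]
    exact (S.time_strictMono i.succ_pos).ne'
  have hsub := closure_minimal (s := Iio (S.time (i + 1))) hlt hcl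
  rw [closure_Iio' ⟨0, pos_iff_ne_zero.2 h0⟩] at hsub
  exact hsub ht

/-- A sequence of choices can be constructed one by one. -/
theorem exists_choices {A : ℕ → (ℕ → Bool) → Prop} (h0 : ∀ b, A 0 b)
    (hcongr : ∀ n b b', (∀ j < n, b j = b' j) → A n b → A n b')
    (hstep : ∀ n b, A n b → ∃ β, A (n + 1) (Function.update b n β)) : ∃ b, ∀ n, A n b := by
  choose! f hf using hstep
  let B : ℕ → ℕ → Bool := fun n =>
    Nat.rec (fun _ => false) (fun n b => Function.update b n (f n b)) n
  have hB : ∀ n, B (n + 1) = Function.update (B n) n (f n (B n)) := fun n => rfl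
  have hA : ∀ n, A n (B n) := by
    intro n
    induction n with
    | zero => exact h0 _
    | succ n ih => rw [hB]; exact hf n _ ih
  refine ⟨fun n => B (n + 1) n, fun n => hcongr n _ _ ?_ (hA n)⟩
  induction n with
  | zero => simp
  | succ n ih =>
    intro j hj
    rcases Nat.lt_succ_iff_lt_or_eq.1 hj with hj | rfl
    · rw [hB, Function.update_of_ne hj.ne]
      exact ih j hj
    · rfl

theorem IsMotion.pot_le {G : Layout} {p : ℝ≥0 → Plane} (hp : IsMotion G.free p) (b : ℕ → Bool)
    (n : ℕ) {s t : ℝ≥0} (hst : s ≤ t) : G.pot b n (p t) ≤ G.pot b n (p s) + (t - s) := by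
  have h := (G.ofReal_abs_pot_sub_le b n (p s) (p t)).trans (hp.geodesicDist_le hst)
  rw [ENNReal.ofReal_le_ofReal_iff (sub_nonneg.2 (NNReal.coe_le_coe.2 hst))] at h
  linarith [(abs_le.1 h).1]

/-- The target can choose its path such that, at the beginning of each phase, the tracker is behind
the target by the required amount. -/
theorem exists_choices_pot_le
    (T : TrackerStrategy (layout hl hd).free !₂[(layout hl hd).mid (fun _ => false) 0, -d₀]) :
    ∃ b, ∀ n, (layout hl hd).pot b n
        (T.path ((strategy hl hd).report b) ((strategy hl hd).time n)) ≤
      (layout hl hd).base n - gap lam d₀ n := by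
  refine exists_choices ?_ ?_ ?_
  · intro b
    refine ((layout hl hd).pot_le _ _ _).trans ?_
    rw [(strategy hl hd).time_zero, T.start]
    simp [Layout.base, gap, phaseTime]
  · intro n b b' h hb
    rw [← (layout hl hd).pot_congr h]
    cases n with
    | zero => rwa [(strategy hl hd).time_zero, T.start] at hb ⊢
    | succ n => rwa [← (strategy hl hd).path_congr T (fun j hj => h j (by omega)) le_rfl]
  · intro n b hb
    obtain ⟨β, hβ⟩ := (layout hl hd).exists_pot_succ_le b (n := n)
      ((T.motion ((strategy hl hd).report b)).1 ((strategy hl hd).time (n + 1)))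
    refine ⟨β, ?_⟩
    rw [(strategy hl hd).path_congr T (b' := b) (i := n)
      (fun j hj => Function.update_of_ne hj.ne _ _) le_rfl]
    refine hβ.trans (max_le ?_ ?_)
    -- either the tracker is not past the fork, or it has guessed wrongly
    · have h1 := fork_far hl hd n
      have h2 := storeys_mul_unit hl d₀ n
      have h3 : (layout hl hd).base (n + 1) =
          (layout hl hd).base n + 5 * storeys lam * unitHeight lam d₀ n := rfl
      have h4 : (layout hl hd).v n = unitHeight lam d₀ n := rfl
      rw [h3, h4]
      linarith
    · have h1 := (T.motion ((strategy hl hd).report b)).pot_le b n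
        ((strategy hl hd).time_strictMono n.lt_succ_self).le
      have h2 := loss_le hl hd n
      have h3 := storeys_mul_unit hl d₀ n
      have h4 : (layout hl hd).base (n + 1) =
          (layout hl hd).base n + 5 * storeys lam * unitHeight lam d₀ n := rfl
      have h5 : ((strategy hl hd).time (n + 1) : ℝ) =
          (strategy hl hd).time n + (1 + 1 / lam) * gap lam d₀ n := rfl
      have h6 : (layout hl hd).v n = unitHeight lam d₀ n := rfl
      have h7 := gap_succ lam d₀ n
      have e : climb lam * ((1 + 1 / lam) * gap lam d₀ n) = (1 + 1 / lam) * gap lam d₀ n -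
          1 / 200 * ((1 + 1 / lam) * gap lam d₀ n) / lam := by
        rw [climb]
        ring
      simp only [Nat.succ_eq_add_one] at h1
      rw [h5, add_sub_cancel_left] at h1
      rw [h4, h6, h3, h7, e]
      have e' : 1 / 100 * ((1 + 1 / lam) * gap lam d₀ n) / lam =
        2 * (1 / 200 * ((1 + 1 / lam) * gap lam d₀ n) / lam) := by ring
      linarith

/-- The target gets away from a tracker of lower potential. -/
theorem ofReal_le_geodesicDist_target (b : ℕ → Bool) (n : ℕ) {t : ℝ≥0}
    (ht : phaseTime lam d₀ n ≤ t) {p : Plane} {d : ℝ}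
    (hp : (layout hl hd).pot b n p ≤ climb lam * t - d) :
    ENNReal.ofReal d ≤ geodesicDist (layout hl hd).free p (targetAt hl hd b t) := by
  refine le_trans (ENNReal.ofReal_le_ofReal ?_) ((layout hl hd).ofReal_abs_pot_sub_le b n _ _)
  have hy : (layout hl hd).base n ≤ climb lam * t := by
    rw [base_layout]
    exact mul_le_mul_of_nonneg_left ht (climb_pos hl).le
  have hq : (layout hl hd).pot b n (targetAt hl hd b t) = climb lam * t :=
    Layout.pot_of_inTube _ (Layout.inTube_xpos _ hy) hy
  rw [hq, abs_sub_comm]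
  exact le_trans (by linarith) (le_abs_self _)

theorem exists_phase (hl : 1 ≤ lam) (hd : 0 < d₀) (t : ℝ≥0) :
    ∃ n, phaseTime lam d₀ n ≤ t ∧ (t : ℝ) < phaseTime lam d₀ (n + 1) := by
  have hc := climb_pos hl
  obtain ⟨n, h1, h2⟩ := (layout hl hd).exists_level (y := climb lam * t) (by positivity)
  rw [base_layout] at h1 h2
  exact ⟨n, le_of_mul_le_mul_left h1 hc, lt_of_mul_lt_mul_left h2 hc.le⟩

theorem geodesicDist_report_le (b : ℕ → Bool) {n : ℕ} {t : ℝ≥0} (h1 : phaseTime lam d₀ n ≤ t)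
    (h2 : (t : ℝ) < phaseTime lam d₀ (n + 1)) :
    geodesicDist (layout hl hd).free (targetAt hl hd b t)
      (targetAt hl hd (revealed lam d₀ b t) t) ≤ ENNReal.ofReal (16 * unitHeight lam d₀ n) := by
  have hc := climb_pos hl
  have hlt : ∀ j < n, b j = revealed lam d₀ b t j := by
    intro j hj
    rw [revealed, if_neg]
    exact not_lt.2 (((phaseTime_strictMono hl hd).monotone hj).trans h1)
  have hn : revealed lam d₀ b t n = false := if_pos h2
  cases hb : b n with
  | false =>
    have e : targetAt hl hd b t = targetAt hl hd (revealed lam d₀ b t) t := by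
      refine targetAt_congr hl hd (i := n) (fun j hj => ?_) h2.le
      rcases hj.lt_or_eq with hj | rfl
      · exact hlt j hj
      · rw [hb, hn]
    rw [← e, geodesicDist_self ((isMotion_targetAt hl hd b).1 t)]
    exact bot_le
  | true =>
    refine (layout hl hd).geodesicDist_xpos_le hlt hb hn ?_ ?_
    · rw [base_layout]
      exact mul_le_mul_of_nonneg_left h1 hc.le
    · rw [base_layout]
      exact mul_lt_mul_of_pos_left h2 hc

theorem geodesicDist_start :
    geodesicDist (layout hl hd).free !₂[(layout hl hd).mid (fun _ => false) 0, -d₀]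
      !₂[(layout hl hd).mid (fun _ => false) 0, 0] = ENNReal.ofReal d₀ := by
  set G := layout hl hd with hG
  refine le_antisymm ?_ ?_
  · refine (geodesicDist_vertical_le fun u hu => G.mid_mem_free _ 0 ?_).trans_eq ?_
    · rw [uIcc_of_le (by linarith)] at hu
      exact hu.2.trans_lt (by simpa [Layout.base] using G.v_zero_pos)
    · rw [sub_zero, abs_neg, abs_of_pos hd]
  · have h := ofReal_le_geodesicDist_target hl hd (fun _ => false) 0 (t := 0) (d := d₀)
      (p := !₂[G.mid (fun _ => false) 0, -d₀]) le_rfl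
      ((G.pot_le _ _ _).trans (by simp))
    have e := (strategy hl hd).start (fun _ => false)
    rwa [show targetAt hl hd (fun _ => false) 0 = _ from e] at h

theorem pathProportionateError_of_pot_le {b : ℕ → Bool} {p : ℝ≥0 → Plane}
    (hp : IsMotion (layout hl hd).free p)
    (hb : ∀ n, (layout hl hd).pot b n (p ((strategy hl hd).time n)) ≤
      (layout hl hd).base n - gap lam d₀ n) :
    PathProportionateError (layout hl hd).free lam p ((strategy hl hd).target b)
      ((strategy hl hd).report b) := by
  intro t
  obtain ⟨n, h1, h2⟩ := exists_phase hl hd t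
  refine (geodesicDist_report_le hl hd b h1 h2).trans ?_
  have hl0 : 0 < lam := by linarith
  rw [ENNReal.le_div_iff_mul_le (Or.inl (by simpa using hl0)) (Or.inl ENNReal.ofReal_ne_top),
    ← ENNReal.ofReal_mul' hl0.le]
  refine ofReal_le_geodesicDist_target hl hd b n h1 ?_
  have h3 := hp.pot_le b n (s := (strategy hl hd).time n) (t := t) h1
  have h4 : (((strategy hl hd).time n : ℝ≥0) : ℝ) = phaseTime lam d₀ n := rfl
  have h5 := hb n
  rw [base_layout] at h5
  rw [h4] at h3
  have h6 := unit_le hl hd n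
  rw [mul_one_div, le_div_iff₀ hl0] at h6
  have h7 := loss_le hl hd n
  have h8 : unitHeight lam d₀ n ≤ unitHeight lam d₀ n * lam :=
    le_mul_of_one_le_right (unit_pos hl hd n).le hl
  rw [phaseTime_succ] at h2
  have h9 : 1 / 200 / lam * (t - phaseTime lam d₀ n) ≤
      1 / 200 / lam * ((1 + 1 / lam) * gap lam d₀ n) :=
    mul_le_mul_of_nonneg_left (by linarith) (by positivity)
  have e1 : climb lam * t = climb lam * phaseTime lam d₀ n + (t - phaseTime lam d₀ n) -
      1 / 200 / lam * (t - phaseTime lam d₀ n) := by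
    rw [climb]
    ring
  have e2 : 1 / 200 / lam * ((1 + 1 / lam) * gap lam d₀ n) =
      1 / 2 * (1 / 100 * ((1 + 1 / lam) * gap lam d₀ n) / lam) := by ring
  have hu := unit_pos hl hd n
  linarith

end Strategy

end Tracking

theorem mainTheorem6 :
    ∃ c : ℝ, 0 < c ∧ ∀ lam : ℝ, 1 ≤ lam → ∀ d₀ : ℝ, 0 < d₀ →
      ∃ (F : Set Tracking.Plane) (p₀ q₀ : Tracking.Plane),
        Tracking.IsPolygonalEnvironment F ∧
        Tracking.geodesicDist F p₀ q₀ = ENNReal.ofReal d₀ ∧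
        ∃ S : Tracking.PhaseStrategy F q₀, ∀ T : Tracking.TrackerStrategy F p₀,
          ∃ b : ℕ → Bool,
            Tracking.PathProportionateError F lam
              (T.path (S.report b)) (S.target b) (S.report b) ∧
            ∀ n : ℕ,
              ENNReal.ofReal (d₀ + c * (S.time n : ℝ) / lam) ≤
                Tracking.geodesicDist F
                  (T.path (S.report b) (S.time n)) (S.target b (S.time n)) ∧
              ENNReal.ofReal ((S.time (n + 1) : ℝ) - (S.time n : ℝ)) ≤
                ENNReal.ofReal (1 + 1 / lam) *
                  Tracking.geodesicDist F
                    (T.path (S.report b) (S.time n)) (S.target b (S.time n)) := by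
  refine ⟨1 / 200, by norm_num, fun lam hl d₀ hd =>
    ⟨_, _, _, (Tracking.layout hl hd).isPolygonalEnvironment_free,
      Tracking.geodesicDist_start hl hd, Tracking.strategy hl hd, fun T => ?_⟩⟩
  obtain ⟨b, hb⟩ := Tracking.exists_choices_pot_le hl hd T
  refine ⟨b, Tracking.pathProportionateError_of_pot_le hl hd (T.motion _) hb, fun n => ?_⟩
  have hgap : ENNReal.ofReal (Tracking.gap lam d₀ n) ≤
      Tracking.geodesicDist (Tracking.layout hl hd).free
        (T.path ((Tracking.strategy hl hd).report b) ((Tracking.strategy hl hd).time n))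
        ((Tracking.strategy hl hd).target b ((Tracking.strategy hl hd).time n)) := by
    refine Tracking.ofReal_le_geodesicDist_target hl hd b n le_rfl ?_
    have := hb n
    rwa [Tracking.base_layout] at this
  refine ⟨hgap, ?_⟩
  have e : ((Tracking.strategy hl hd).time (n + 1) : ℝ) - (Tracking.strategy hl hd).time n =
      (1 + 1 / lam) * Tracking.gap lam d₀ n := by
    exact sub_eq_of_eq_add' (Tracking.phaseTime_succ lam d₀ n)
  rw [e, ENNReal.ofReal_mul (by positivity)]
  gcongr
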